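/- Fix integers $n, d\ge 0$, reals $\kappa\ge 0$, $M$ and $a<b$. There are step sizes $\lambda_T\in(0,1]$ $(T\ge 1)$ and constants $K,k$, depending only on $(n,d,\kappa,M,a,b)$, such that the following holds. **Setting.** Let $I_0,I_1,\dots$ be independent random problem instances on $n$ nodes. Instance $I_t$ consists of a partition of the nodes into labeled nodes $L_t\neq\emptyset$ and unlabeled nodes $U_t$, binary labels $y_t(v)\in\{0,1\}$ (shown to the learner for $v\in L_t$, and the prediction target for $v\in U_t$), and symmetric similarities $\tilde d_t(u,v)$, $u\ne v$. Assume that for each $t$ the similarities $(\tilde d_t(u,v))_{\{u,v\}}$ of all unordered pairs of distinct nodes have a joint density bounded by $\kappa$, and that $|\tilde d_t(u,v)|\le M$ almost surely. Let $\mathcal P\subseteq\mathbb R$ be a set of parameters with $[a,b]\subseteq\mathcal P$ such that for each $t$, almost surely, the polynomial-kernel weights $w(u,v)=(\tilde d_t(u,v)+\tilde\alpha)^d$ $(u\neq v)$ are nonnegative for all $\tilde\alpha\in\mathcal P$ (for example $\tilde d\ge 0$ and $\mathcal P=[0,\infty)$). For a parameter $\tilde\alpha$, let $f$ be a minimizer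 of the quadratic objective $\sum_{u,v}w(u,v)(f(u)-f(v))^2$ over all $f$ with values in $[0,1]$ and $f(v)=y_t(v)$ for $v\in L_t$; predict for $u\in U_t$ the label $1$ if $f(u)\ge\frac12$ and $0$ otherwise; and let $l_t(\tilde\alpha)\in[0,1]$ be the average over $u\in U_t$ of $\ell(\text{predicted label},y_t(u))$ (read as $0$ if $U_t=\emptyset$), where $\ell:\{0,1\}^2\to[0,1]$ is any fixed loss function. **Dispersion.** The sequence $l_0,l_1,\dots$ is $\frac12$-dispersed on $\mathcal P$, for every Lipschitz constant $L\ge0$: for all $T\ge1$ and all $\epsilon\ge T^{-1/2}$, $$\mathbb E\Big[\max_{\rho,\rho'\in\mathcal P,\ |\rho-\rho'|\le\epsilon}\big|\{t<T: l_t(\rho)-l_t(\rho')>L|\rho-\rho'|\}\big|\Big]\le K\,\epsilon T\,(1+\log T)^k .$$ **Regret.** Let continuous exponential weights on $C=[a,b]$ with step size $\lambda=\lambda_T$ be the algorithm with $w_0\equiv1$ that in round $t=0,\dots,T-1$ samples $\rho_t\in C$ with density $w_t(\rho)/\int_C w_t$ (with fresh randomness), observes the function $l_t$, and sets $w_{t+1}(\rho)=e^{\lambda(1-l_t(\rho))}w_t(\rho)$.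 Then for every $T\ge1$ it is almost surely well defined, and $$\mathbb E\Big[\sum_{t<T}l_t(\rho_t)-\inf_{\rho\in C}\sum_{t<T}l_t(\rho)\Big]\le K\sqrt T\,(1+\log T)^k .$$ In both bounds the expectation over the random instances is an upper expectation ($\mathbb E X\le B$ means that some integrable $g\ge X$ a.s. has $\mathbb E g\le B$), which is the usual expectation for integrable $X$. -/

import Mathlib

open MeasureTheory ProbabilityTheory
open scoped NNReal ENNReal

/-- Unordered pairs of distinct nodes, the possible edges of a graph on `n` nodes. -/
abbrev NodePair (n : ℕ) : Type := {e : Sym2 (Fin n) // ¬ e.IsDiag}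

/-- A semi-supervised problem instance on `n` nodes: `labeled v` says whether `v` lies in `L` or in
`U`; `label v` is the binary label of `v` (shown to the learner for `v ∈ L`, the target `τ v` for
`v ∈ U`); `sim` is the symmetric similarity of pairs of distinct nodes. -/
structure SSLInstance (n : ℕ) where
  labeled : Fin n → Bool
  label : Fin n → Bool
  sim : NodePair n → ℝ

/-- The product σ-algebra (discrete on the finite parts, Borel on the similarities). -/
instance (n : ℕ) : MeasurableSpace (SSLInstance n) :=
  MeasurableSpace.comap (fun I => (I.labeled, I.label, I.sim)) inferInstance

namespace SSLInstance

variable {n : ℕ}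

/-- What the labeling algorithm is told about the labels. -/
def observed (I : SSLInstance n) : Fin n → Option Bool :=
  fun v => if I.labeled v then some (I.label v) else none

/-- The unlabeled nodes `U`. -/
def unlabeledNodes (I : SSLInstance n) : Finset (Fin n) :=
  Finset.univ.filter fun v => I.labeled v = false

/-- The polynomial kernel `w(u,v) = (sim(u,v) + α) ^ deg`, without self-loops. -/
def polyKernel (I : SSLInstance n) (deg : ℕ) (α : ℝ) : Fin n → Fin n → ℝ :=
  fun u v =>
    if h : u = v then 0 else (I.sim ⟨s(u, v), by simpa using h⟩ + α) ^ deg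

end SSLInstance

/-- The quadratic objective `∑_{u,v} w(u,v) (f u - f v)²`. -/
def quadraticObjective {n : ℕ} (w : Fin n → Fin n → ℝ) (f : Fin n → ℝ) : ℝ :=
  ∑ u, ∑ v, w u v * (f u - f v) ^ 2

/-- Fractional labelings `f ∈ [0,1]^V` that agree with the observed labels. -/
def feasibleLabelings {n : ℕ} (y : Fin n → Option Bool) : Set (Fin n → ℝ) :=
  {f | (∀ v, f v ∈ Set.Icc (0 : ℝ) 1) ∧ ∀ v b, y v = some b → f v = if b then 1 else 0}

theorem exists_quadraticMinimizer {n : ℕ} (w : Fin n → Fin n → ℝ) (y : Fin n → Option Bool) :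
    ∃ f ∈ feasibleLabelings y, IsMinOn (quadraticObjective w) (feasibleLabelings y) f := by
  have hcl : IsClosed (feasibleLabelings y) := by
    have : feasibleLabelings y = (⋂ v, {f : Fin n → ℝ | f v ∈ Set.Icc (0 : ℝ) 1}) ∩
        ⋂ v, ⋂ b, ⋂ (_ : y v = some b), {f : Fin n → ℝ | f v = if b then 1 else 0} := by
      ext f
      simp [feasibleLabelings]
    rw [this]
    refine IsClosed.inter (isClosed_iInter fun v => isClosed_Icc.preimage (continuous_apply v)) ?_
    exact isClosed_iInter fun v => isClosed_iInter fun b => isClosed_iInter fun _ =>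
      isClosed_eq (continuous_apply v) continuous_const
  have hK : IsCompact (feasibleLabelings y) :=
    (isCompact_univ_pi fun _ : Fin n => isCompact_Icc (a := (0 : ℝ)) (b := 1)).of_isClosed_subset
      hcl fun f hf v _ => hf.1 v
  have hne : (feasibleLabelings y).Nonempty := by
    refine ⟨fun v => if y v = some true then 1 else 0, fun v => ?_, fun v b hb => ?_⟩
    · dsimp only
      split_ifs <;> simp
    · cases b <;> simp [hb]
  have hc : Continuous (quadraticObjective w) := by
    unfold quadraticObjective
    fun_prop
  exact hK.exists_isMinOn hne hc.continuousOn

/-- The soft labels: a minimizer of the quadratic objective among the fractional labelings that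
agree with the observed labels. -/
noncomputable def softLabels {n : ℕ} (w : Fin n → Fin n → ℝ) (y : Fin n → Option Bool) :
    Fin n → ℝ :=
  (exists_quadraticMinimizer w y).choose

theorem softLabels_spec {n : ℕ} (w : Fin n → Fin n → ℝ) (y : Fin n → Option Bool) :
    softLabels w y ∈ feasibleLabelings y ∧
      IsMinOn (quadraticObjective w) (feasibleLabelings y) (softLabels w y) :=
  (exists_quadraticMinimizer w y).choose_spec

/-- The predicted labels, obtained by rounding the soft labels at `1/2`. -/
noncomputable def predictedLabels {n : ℕ} (w : Fin n → Fin n → ℝ) (y : Fin n → Option Bool) :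
    Fin n → Bool :=
  fun v => decide ((1 / 2 : ℝ) ≤ softLabels w y v)

/-- The average loss over the unlabeled nodes when the graph is built with the polynomial kernel of
degree `deg` and parameter `α`. -/
noncomputable def SSLInstance.loss {n : ℕ} (I : SSLInstance n) (ell : Bool → Bool → ℝ) (deg : ℕ)
    (α : ℝ) : ℝ :=
  (∑ u ∈ I.unlabeledNodes, ell (predictedLabels (I.polyKernel deg α) I.observed u) (I.label u)) /
    (I.unlabeledNodes.card : ℝ)

/-- The law `ν` has a (joint) Lebesgue density that is at most `κ`. -/
def IsBoundedDensity {ι : Type*} [Fintype ι] (κ : ℝ≥0) (ν : Measure (ι → ℝ)) : Prop :=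
  ∃ g : (ι → ℝ) → ℝ≥0∞, Measurable g ∧ (∀ x, g x ≤ κ) ∧ ν = volume.withDensity g

/-- `E[X] ≤ b`, read as an upper expectation, so that no measurability of `X` is presupposed and no
value is assigned by convention; see `expectationLE_iff` for integrable `X`. -/
def ExpectationLE {Ω : Type*} [MeasurableSpace Ω] (μ : Measure Ω) (X : Ω → ℝ) (b : ℝ) : Prop :=
  ∃ g : Ω → ℝ, Integrable g μ ∧ (∀ᵐ ω ∂μ, X ω ≤ g ω) ∧ ∫ ω, g ω ∂μ ≤ b

theorem expectationLE_iff {Ω : Type*} [MeasurableSpace Ω] {μ : Measure Ω} {X : Ω → ℝ}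
    (hX : Integrable X μ) (b : ℝ) : ExpectationLE μ X b ↔ ∫ ω, X ω ∂μ ≤ b :=
  ⟨fun ⟨_, hg, hle, hb⟩ => (integral_mono_ae hX hg hle).trans hb,
    fun h => ⟨X, hX, Filter.Eventually.of_forall fun _ => le_rfl, h⟩⟩

/-- The largest number of the functions `l 0, …, l (T-1)` that violate the `L`-Lipschitz inequality
at a common pair of points of `P` at distance at most `ε`. -/
noncomputable def maxNonLipschitz (P : Set ℝ) (L : ℝ) (l : ℕ → ℝ → ℝ) (T : ℕ) (ε : ℝ) : ℝ :=
  sSup {x : ℝ | ∃ ρ ∈ P, ∃ ρ' ∈ P, |ρ - ρ'| ≤ ε ∧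
    x = ({t : ℕ | t < T ∧ l t ρ - l t ρ' > L * |ρ - ρ'|}.ncard : ℝ)}

/-- The sequence of random functions `l 0, l 1, …` is `β`-dispersed on `P` for the Lipschitz
constant `L`, where the soft-O bound `Õ(ε T)` is `K ε T (1 + log T) ^ k`. -/
def IsDispersedWith {Ω : Type*} [MeasurableSpace Ω] (μ : Measure Ω) (P : Set ℝ) (β L K : ℝ) (k : ℕ)
    (l : ℕ → Ω → ℝ → ℝ) : Prop :=
  ∀ T : ℕ, 1 ≤ T → ∀ ε : ℝ, (T : ℝ) ^ (-β) ≤ ε →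
    ExpectationLE μ (fun ω => maxNonLipschitz P L (fun t => l t ω) T ε)
      (K * (ε * T) * (1 + Real.log T) ^ k)

/-- The weights of continuous exponential weights with step size `η`, for utilities `1 - l t`. -/
noncomputable def expWeight (η : ℝ) (l : ℕ → ℝ → ℝ) : ℕ → ℝ → ℝ
  | 0, _ => 1
  | t + 1, ρ => Real.exp (η * (1 - l t ρ)) * expWeight η l t ρ

/-- The law on the parameter domain `C` from which the algorithm samples `ρ_t`: its density is
`w_t / W_t` with `W_t = ∫_C w_t`. -/
noncomputable def samplingLaw (C : Set ℝ) (η : ℝ) (l : ℕ → ℝ → ℝ) (t : ℕ) : Measure ℝ :=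
  (volume.restrict C).withDensity fun ρ =>
    ENNReal.ofReal (expWeight η l t ρ / ∫ x in C, expWeight η l t x)

/-- The joint law of the parameters `ρ_0, …, ρ_{T-1}` that the algorithm outputs when it faces the
losses `l`; the samples of different rounds use fresh randomness. -/
noncomputable def outputLaw (C : Set ℝ) (η : ℝ) (l : ℕ → ℝ → ℝ) (T : ℕ) : Measure (Fin T → ℝ) :=
  Measure.pi fun t : Fin T => samplingLaw C η l t

/-- The regret of the outputs `ρ` against the best fixed parameter of `C` in hindsight. -/
noncomputable def regret (C : Set ℝ) (l : ℕ → ℝ → ℝ) (T : ℕ) (ρ : Fin T → ℝ) : ℝ :=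
  (∑ t : Fin T, l t (ρ t)) - sInf ((fun r => ∑ t : Fin T, l t r) '' C)

/-! With positive weights the soft labels solve a linear system: labeled values are prescribed, and
every unlabeled value is the weighted mean of the others. By Cramer's rule each prediction depends
only on the signs of two determinants, which are polynomials in the kernel weights and hence in the
shifted similarities `s e + α`. Changing `α` moves the point `s` along the diagonal direction `(1,
…, 1)`. The loss can therefore change only at a zero, along this line, of one of finitely many fixed
polynomials that does not vanish on the whole line. There are at most `∑ totalDegree` such
crossings.

A crossing is unlikely to lie in a short interval of length `h`: translating `s` along the diagonal
translates its crossings, so about `1/h` consecutive cells are all at least as likely, in Lebesgue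
volume on a slightly larger box, as the given one, while each `s` meets only boundedly many cells.
This gives probability `O(h)` under any bounded density (`measure_crossingSet_le`), with no analysis
of the zero set.

For a fixed cell the number of instances crossing in it is a sum of independent indicators with mean
`O(εT)`. An exponential moment summed over all cells controls the expected maximum up to an additive
`log T` (`exists_integrable_bound_of_counts`). The sum over infinitely many cells converges because
the crossing probabilities of each instance have a bounded sum. Two neighbouring cells cover any
interval of length `ε`, which gives dispersion.

For the regret, dispersion with `L = 0` and `ε = T^(-1/2)` bounds the loss increase on an interval
around any comparator. The potential argument for exponential weights then costs `log(1/ε)/η + ηT`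
more (`integral_regret_le`), and `η = T^(-1/2)` balances these terms. -/

/-! ### Soft labels as the solution of a linear system. -/

section HarmonicSystem

variable {n : ℕ}

/-- The matrix of the linear system `f v = y v` (`v` labeled), `∑ x, w v x * (f v - f x) = 0`
(`v` unlabeled). -/
def harmonicMatrix {R : Type*} [CommRing R] (w : Fin n → Fin n → R) (y : Fin n → Option Bool) :
    Matrix (Fin n) (Fin n) R :=
  Matrix.of fun v x =>
    if (y v).isSome then (if v = x then 1 else 0) else (if v = x then ∑ z, w v z else 0) - w v x

/-- The right-hand side of the system with matrix `harmonicMatrix w y`. -/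
def harmonicRhs (R : Type*) [CommRing R] (y : Fin n → Option Bool) : Fin n → R :=
  fun v => if y v = some true then 1 else 0

/-- The expression `det A * (2 f u - 1)`, where `A f = b` is the harmonic system. -/
def roundingDet {R : Type*} [CommRing R] (w : Fin n → Fin n → R) (y : Fin n → Option Bool)
    (u : Fin n) : R :=
  2 * ((harmonicMatrix w y).updateCol u (harmonicRhs R y)).det - (harmonicMatrix w y).det

theorem map_harmonicMatrix {R S : Type*} [CommRing R] [CommRing S] (φ : R →+* S)
    (w : Fin n → Fin n → R) (y : Fin n → Option Bool) :
    φ.mapMatrix (harmonicMatrix w y) = harmonicMatrix (fun u v => φ (w u v)) y := by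
  ext v x
  simp only [harmonicMatrix, RingHom.mapMatrix_apply, Matrix.map_apply, Matrix.of_apply]
  split_ifs <;> simp

theorem map_det_harmonicMatrix {R S : Type*} [CommRing R] [CommRing S] (φ : R →+* S)
    (w : Fin n → Fin n → R) (y : Fin n → Option Bool) :
    φ (harmonicMatrix w y).det = (harmonicMatrix (fun u v => φ (w u v)) y).det := by
  rw [RingHom.map_det, map_harmonicMatrix]

theorem map_roundingDet {R S : Type*} [CommRing R] [CommRing S] (φ : R →+* S)
    (w : Fin n → Fin n → R) (y : Fin n → Option Bool) (u : Fin n) :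
    φ (roundingDet w y u) = roundingDet (fun u v => φ (w u v)) y u := by
  have h : φ.mapMatrix ((harmonicMatrix w y).updateCol u (harmonicRhs R y)) =
      (harmonicMatrix (fun u v => φ (w u v)) y).updateCol u (harmonicRhs S y) := by
    rw [← map_harmonicMatrix]
    ext v x
    simp only [RingHom.mapMatrix_apply, Matrix.map_apply, Matrix.updateCol_apply, harmonicRhs]
    split_ifs <;> simp
  simp only [roundingDet, map_sub, map_mul, map_ofNat, RingHom.map_det, h,
    map_harmonicMatrix]

theorem harmonicMatrix_mulVec_of_isSome (w : Fin n → Fin n → ℝ) {y : Fin n → Option Bool}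
    (f : Fin n → ℝ) {v : Fin n} (hv : (y v).isSome) :
    (harmonicMatrix w y).mulVec f v = f v := by
  simp [harmonicMatrix, Matrix.mulVec, dotProduct, hv]

theorem harmonicMatrix_mulVec_of_none (w : Fin n → Fin n → ℝ) {y : Fin n → Option Bool}
    (f : Fin n → ℝ) {v : Fin n} (hv : y v = none) :
    (harmonicMatrix w y).mulVec f v = ∑ x, w v x * (f v - f x) := by
  simp [harmonicMatrix, Matrix.mulVec, dotProduct, hv, sub_mul, mul_sub, Finset.sum_sub_distrib,
    Finset.sum_mul]

/-- The maximum principle. -/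
theorem nonpos_of_harmonicMatrix_mulVec_eq_zero {w : Fin n → Fin n → ℝ}
    (hw : ∀ u v, u ≠ v → 0 < w u v) {y : Fin n → Option Bool} (hy : ∃ v, (y v).isSome)
    {g : Fin n → ℝ} (hg : (harmonicMatrix w y).mulVec g = 0) (v : Fin n) : g v ≤ 0 := by
  obtain ⟨l, hl⟩ := hy
  have : Nonempty (Fin n) := ⟨l⟩
  obtain ⟨m, hm⟩ := Finite.exists_max g
  refine (hm v).trans ?_
  by_contra! hpos
  have hlz : g l = 0 := by
    rw [← harmonicMatrix_mulVec_of_isSome w g hl, hg]; rfl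
  have hmn : y m = none := by
    by_contra h
    have := harmonicMatrix_mulVec_of_isSome w g (Option.isSome_iff_ne_none.2 h)
    rw [hg] at this
    simp [← this] at hpos
  have hml : m ≠ l := by rintro rfl; linarith
  have hsum := harmonicMatrix_mulVec_of_none w g hmn
  rw [hg] at hsum
  have h0 : ∀ x ∈ Finset.univ, 0 ≤ w m x * (g m - g x) := by
    intro x _
    by_cases hx : m = x
    · simp [hx]
    · exact mul_nonneg (hw m x hx).le (sub_nonneg.2 (hm x))
  -- At the maximum all terms are nonnegative with zero sum; all off-diagonal weights are positive,
  -- so the term of the labeled node `l` forces `g m = g l = 0`.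
  have := (Finset.sum_eq_zero_iff_of_nonneg h0).1 hsum.symm l (Finset.mem_univ l)
  rw [hlz, sub_zero] at this
  exact (mul_pos (hw m l hml) hpos).ne' this

theorem det_harmonicMatrix_ne_zero {w : Fin n → Fin n → ℝ} (hw : ∀ u v, u ≠ v → 0 < w u v)
    {y : Fin n → Option Bool} (hy : ∃ v, (y v).isSome) : (harmonicMatrix w y).det ≠ 0 := by
  intro h
  obtain ⟨g, hg0, hg⟩ := Matrix.exists_mulVec_eq_zero_iff.2 h
  refine hg0 (funext fun v => le_antisymm
    (nonpos_of_harmonicMatrix_mulVec_eq_zero hw hy hg v) ?_)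
  have := nonpos_of_harmonicMatrix_mulVec_eq_zero hw hy (g := -g)
    (by rw [Matrix.mulVec_neg, hg, neg_zero]) v
  simpa using this

/-- Every pair containing `v` occurs twice in the double sum, which doubles the usual coefficients;
the term `(v, v)` does not move, hence the correction by `w v v`. -/
theorem quadraticObjective_add_single {w : Fin n → Fin n → ℝ} (hsymm : ∀ u v, w u v = w v u)
    (f : Fin n → ℝ) (v : Fin n) (t : ℝ) :
    quadraticObjective w (f + Pi.single v t) = quadraticObjective w f +
      4 * t * ∑ x, w v x * (f v - f x) + 2 * t ^ 2 * (∑ x, w v x - w v v) := by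
  have key : ∀ u x, w u x * ((f + Pi.single v t : Fin n → ℝ) u - (f + Pi.single v t : Fin n → ℝ) x) ^ 2 =
      w u x * (f u - f x) ^ 2 + (if u = v then 2 * t * (w u x * (f u - f x)) + t ^ 2 * w u x else 0)
      + (if x = v then 2 * t * (w x u * (f x - f u)) + t ^ 2 * w x u else 0)
      - (if u = v then if x = v then 2 * t ^ 2 * w u x else 0 else 0) := by
    intro u x
    rw [hsymm x u]
    simp only [Pi.add_apply, Pi.single_apply]
    split_ifs <;> ring
  simp only [quadraticObjective, key, Finset.sum_add_distrib, Finset.sum_sub_distrib,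
    Finset.sum_ite_irrel, Finset.sum_const_zero, Finset.sum_ite_eq', Finset.mem_univ, if_true,
    ← Finset.mul_sum]
  ring

/-- The box constraint is never binding: the weighted mean of values in `[0,1]` is again in `[0,1]`,
so moving one unlabeled value to its mean is a feasible variation. -/
theorem softLabels_harmonic {w : Fin n → Fin n → ℝ} (hsymm : ∀ u v, w u v = w v u)
    (hdiag : ∀ v, w v v = 0) (hw : ∀ u v, u ≠ v → 0 < w u v) {y : Fin n → Option Bool}
    (hy : ∃ v, (y v).isSome) :
    (harmonicMatrix w y).mulVec (softLabels w y) = harmonicRhs ℝ y := by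
  obtain ⟨hf, hmin⟩ := softLabels_spec w y
  set f := softLabels w y
  have hw0 : ∀ u v, 0 ≤ w u v := fun u v => by
    by_cases h : u = v
    · rw [h, hdiag]
    · exact (hw u v h).le
  funext v
  rcases hyv : y v with _ | c
  · rw [harmonicMatrix_mulVec_of_none w f hyv]
    obtain ⟨l, hl⟩ := hy
    have hvl : v ≠ l := by rintro rfl; simp [hyv] at hl
    set W := ∑ x, w v x with hW
    have hWpos : 0 < W := Finset.sum_pos' (fun x _ => hw0 v x) ⟨l, Finset.mem_univ l, hw v l hvl⟩
    set m := (∑ x, w v x * f x) / W with hm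
    have hWm : W * m = ∑ x, w v x * f x := by rw [hm]; field_simp
    have hm0 : 0 ≤ m :=
      div_nonneg (Finset.sum_nonneg fun x _ => mul_nonneg (hw0 v x) (hf.1 x).1) hWpos.le
    have hm1 : m ≤ 1 := by
      rw [hm, div_le_one hWpos, hW]
      exact Finset.sum_le_sum fun x _ => mul_le_of_le_one_right (hw0 v x) (hf.1 x).2
    have hsum : ∑ x, w v x * (f v - f x) = W * (f v - m) := by
      simp only [mul_sub, Finset.sum_sub_distrib, ← Finset.sum_mul]
      rw [hWm]
    have hfeas : f + Pi.single v (m - f v) ∈ feasibleLabelings y := by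
      refine ⟨fun x => ?_, fun x b hb => ?_⟩
      · by_cases hx : x = v
        · subst hx; simpa using ⟨hm0, hm1⟩
        · simpa [hx] using hf.1 x
      · have hx : x ≠ v := by rintro rfl; simp [hyv] at hb
        simpa [hx] using hf.2 x b hb
    have hle : quadraticObjective w f ≤ quadraticObjective w (f + Pi.single v (m - f v)) :=
      hmin hfeas
    rw [quadraticObjective_add_single hsymm, hsum, hdiag, ← hW] at hle
    -- The variation changes the objective by exactly `-2 * W * (f v - m) ^ 2`.
    have h0 : W * (f v - m) ^ 2 ≤ 0 := by nlinarith
    have h1 : (f v - m) ^ 2 = 0 :=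
      le_antisymm (by by_contra! h; nlinarith [mul_pos hWpos h]) (sq_nonneg _)
    rw [hsum, pow_eq_zero_iff (two_ne_zero) |>.1 h1]
    simp [harmonicRhs, hyv]
  · rw [harmonicMatrix_mulVec_of_isSome w f (by simp [hyv])]
    rw [hf.2 v c hyv, harmonicRhs, hyv]
    cases c <;> simp

/-- Cramer's rule, with the denominator cleared so that both sides of the threshold test become
polynomial. -/
theorem det_mul_softLabels {w : Fin n → Fin n → ℝ} (hsymm : ∀ u v, w u v = w v u)
    (hdiag : ∀ v, w v v = 0) (hw : ∀ u v, u ≠ v → 0 < w u v) {y : Fin n → Option Bool}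
    (hy : ∃ v, (y v).isSome) (u : Fin n) :
    (harmonicMatrix w y).det * (2 * softLabels w y u - 1) = roundingDet w y u := by
  have h2 : (harmonicMatrix w y).cramer (harmonicRhs ℝ y) =
      (harmonicMatrix w y).det • softLabels w y := by
    rw [← softLabels_harmonic hsymm hdiag hw hy, Matrix.cramer_eq_adjugate_mulVec,
      Matrix.mulVec_mulVec, Matrix.adjugate_mul, Matrix.smul_mulVec, Matrix.one_mulVec]
  have h3 := congrFun h2 u
  rw [Matrix.cramer_apply] at h3
  rw [roundingDet, h3]
  simp only [Pi.smul_apply, smul_eq_mul]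
  ring

end HarmonicSystem

/-! ### Zeros of polynomials along diagonal lines. -/

section DiagonalCrossings

variable {σ : Type*}

/-- The parameters `α` at which some polynomial of `F` vanishes on the line `α ↦ s + α (1, …, 1)`
without vanishing on the whole line. -/
def diagonalCrossings (F : Finset (MvPolynomial σ ℝ)) (s : σ → ℝ) : Set ℝ :=
  {α | ∃ q ∈ F, MvPolynomial.eval (fun e => s e + α) q = 0 ∧
    ∃ β : ℝ, MvPolynomial.eval (fun e => s e + β) q ≠ 0}

/-- This equivariance under diagonal translation is what later makes all cells comparable in volume.
-/
theorem diagonalCrossings_add_const (F : Finset (MvPolynomial σ ℝ)) (s : σ → ℝ) (c α : ℝ) :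
    α ∈ diagonalCrossings F (fun e => s e + c) ↔ α + c ∈ diagonalCrossings F s := by
  have h : ∀ β, (fun e => s e + c + β) = fun e => s e + (β + c) := fun β => by
    funext e; ring
  simp only [diagonalCrossings, Set.mem_ofPred_eq, h]
  refine exists_congr fun q => and_congr_right fun _ => and_congr_right fun _ => ?_
  exact ⟨fun ⟨β, hβ⟩ => ⟨β + c, hβ⟩, fun ⟨β, hβ⟩ => ⟨β - c, by rwa [sub_add_cancel]⟩⟩

/-- The restriction of `q` to the line `α ↦ s + α (1, …, 1)`. -/
noncomputable def diagonalLine (s : σ → ℝ) (q : MvPolynomial σ ℝ) : Polynomial ℝ :=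
  MvPolynomial.aeval (fun e => Polynomial.C (s e) + Polynomial.X) q

theorem eval_diagonalLine (s : σ → ℝ) (q : MvPolynomial σ ℝ) (α : ℝ) :
    (diagonalLine s q).eval α = MvPolynomial.eval (fun e => s e + α) q := by
  have h : ((Polynomial.aeval α).comp
      (MvPolynomial.aeval fun e => Polynomial.C (s e) + Polynomial.X) : _ →ₐ[ℝ] ℝ) =
      MvPolynomial.aeval fun e => s e + α := by
    ext e; simp
  have := DFunLike.congr_fun h q
  simpa [diagonalLine, Polynomial.aeval_def, MvPolynomial.aeval_eq_eval] using this

theorem natDegree_diagonalLine_le (s : σ → ℝ) (q : MvPolynomial σ ℝ) :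
    (diagonalLine s q).natDegree ≤ q.totalDegree := by
  rw [diagonalLine, MvPolynomial.aeval_def, MvPolynomial.eval₂_eq]
  refine Polynomial.natDegree_sum_le_of_forall_le _ _ fun m hm => ?_
  rw [Polynomial.algebraMap_eq]
  refine (Polynomial.natDegree_C_mul_le _ _).trans ((Polynomial.natDegree_prod_le _ _).trans ?_)
  refine le_trans (Finset.sum_le_sum fun i _ => ?_) (MvPolynomial.le_totalDegree hm)
  refine Polynomial.natDegree_pow_le.trans (mul_le_of_le_one_right (Nat.zero_le _) ?_)
  rw [add_comm, Polynomial.natDegree_X_add_C]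

theorem diagonalCrossings_subset (F : Finset (MvPolynomial σ ℝ)) (s : σ → ℝ) :
    diagonalCrossings F s ⊆ ↑(F.biUnion fun q => (diagonalLine s q).roots.toFinset) := by
  rintro α ⟨q, hq, h0, β, hβ⟩
  rw [← eval_diagonalLine] at h0 hβ
  simp only [Finset.coe_biUnion, Set.mem_iUnion, Finset.mem_coe, Multiset.mem_toFinset]
  refine ⟨q, hq, (Polynomial.mem_roots ?_).2 h0⟩
  rintro h
  simp [h] at hβ

theorem finite_diagonalCrossings (F : Finset (MvPolynomial σ ℝ)) (s : σ → ℝ) :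
    (diagonalCrossings F s).Finite :=
  (Finset.finite_toSet _).subset (diagonalCrossings_subset F s)

theorem ncard_diagonalCrossings_le (F : Finset (MvPolynomial σ ℝ)) (s : σ → ℝ) :
    (diagonalCrossings F s).ncard ≤ ∑ q ∈ F, q.totalDegree := by
  refine (Set.ncard_le_ncard (diagonalCrossings_subset F s) (Finset.finite_toSet _)).trans ?_
  rw [Set.ncard_coe_finset]
  refine Finset.card_biUnion_le.trans (Finset.sum_le_sum fun q _ => ?_)
  exact (Multiset.toFinset_card_le _).trans
    ((Polynomial.card_roots' _).trans (natDegree_diagonalLine_le s q))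

/-- A polynomial of `F` either vanishes on the whole line or has no zero between the two parameters,
where the intermediate value theorem applies. -/
theorem sign_eval_eq_of_no_crossing {F : Finset (MvPolynomial σ ℝ)} {s : σ → ℝ} {ρ ρ' : ℝ}
    (hno : ∀ α ∈ Set.uIcc ρ ρ', α ∉ diagonalCrossings F s) {q : MvPolynomial σ ℝ} (hq : q ∈ F) :
    SignType.sign (MvPolynomial.eval (fun e => s e + ρ) q) =
      SignType.sign (MvPolynomial.eval (fun e => s e + ρ') q) := by
  by_cases hz : ∃ β : ℝ, MvPolynomial.eval (fun e => s e + β) q ≠ 0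
  · set g : ℝ → ℝ := fun α => MvPolynomial.eval (fun e => s e + α) q with hg
    have hcont : Continuous g :=
      (MvPolynomial.continuous_eval q).comp (continuous_pi fun e => by fun_prop)
    have hne : ∀ α ∈ Set.uIcc ρ ρ', g α ≠ 0 := fun α hα h => hno α hα ⟨q, hq, h, hz⟩
    have hivt := intermediate_value_uIcc (hcont.continuousOn (s := Set.uIcc ρ ρ'))
    have h0 : (0 : ℝ) ∉ Set.uIcc (g ρ) (g ρ') := fun h => by
      obtain ⟨α, hα, h⟩ := hivt h
      exact hne α hα h
    change SignType.sign (g ρ) = SignType.sign (g ρ')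
    rw [Set.mem_uIcc] at h0
    rcases lt_or_gt_of_ne (hne ρ Set.left_mem_uIcc) with h | h <;>
    rcases lt_or_gt_of_ne (hne ρ' Set.right_mem_uIcc) with h' | h'
    · rw [sign_neg h, sign_neg h']
    · exact absurd (Or.inl ⟨h.le, h'.le⟩) h0
    · exact absurd (Or.inr ⟨h'.le, h.le⟩) h0
    · rw [sign_pos h, sign_pos h']
  · push Not at hz
    rw [hz, hz]

/-- Having a zero in a compact interval is a closed condition, as a projection along a compact
factor; not vanishing on the whole line is an open condition. -/
theorem measurableSet_diagonalCrossings_inter_Icc [Finite σ] (F : Finset (MvPolynomial σ ℝ))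
    (x y : ℝ) : MeasurableSet {s : σ → ℝ | (diagonalCrossings F s ∩ Set.Icc x y).Nonempty} := by
  have hcont : ∀ q : MvPolynomial σ ℝ,
      Continuous fun p : ℝ × (σ → ℝ) => MvPolynomial.eval (fun e => p.2 e + p.1) q := fun q =>
    (MvPolynomial.continuous_eval q).comp (continuous_pi fun e => by fun_prop)
  have heq : {s : σ → ℝ | (diagonalCrossings F s ∩ Set.Icc x y).Nonempty} =
      ⋃ q ∈ F, ({s | ∃ α ∈ Set.Icc x y, MvPolynomial.eval (fun e => s e + α) q = 0} ∩
        ⋃ β : ℝ, {s | MvPolynomial.eval (fun e => s e + β) q ≠ 0}) := by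
    ext s
    simp only [diagonalCrossings, Set.Nonempty, Set.mem_inter_iff, Set.mem_ofPred_eq,
      Set.mem_iUnion, exists_prop]
    exact ⟨fun ⟨α, ⟨q, hq, h0, hβ⟩, hα⟩ => ⟨q, hq, ⟨α, hα, h0⟩, hβ⟩,
      fun ⟨q, hq, ⟨α, hα, h0⟩, hβ⟩ => ⟨α, ⟨q, hq, h0, hβ⟩, hα⟩⟩
  rw [heq]
  refine Finset.measurableSet_biUnion F fun q _ => MeasurableSet.inter ?_ ?_
  · refine IsClosed.measurableSet ?_
    have himg : {s : σ → ℝ | ∃ α ∈ Set.Icc x y, MvPolynomial.eval (fun e => s e + α) q = 0} =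
        Prod.snd '' {p : Set.Icc x y × (σ → ℝ) |
          MvPolynomial.eval (fun e => p.2 e + (p.1 : ℝ)) q = 0} := by
      ext s
      simp
    rw [himg]
    refine isClosedMap_snd_of_compactSpace _ (isClosed_eq ?_ continuous_const)
    exact (hcont q).comp (f := fun p : Set.Icc x y × (σ → ℝ) => ((p.1 : ℝ), p.2)) (by fun_prop)
  · refine (isOpen_iUnion fun β => ?_).measurableSet
    exact isOpen_ne_fun ((hcont q).comp (f := fun s => (β, s)) (by fun_prop)) continuous_const

end DiagonalCrossings

/-! ### The loss is constant between crossings. -/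

section NoCrossing

variable {n : ℕ}

/-- The polynomial kernel as a polynomial in the similarities. -/
noncomputable def kernelPoly (n deg : ℕ) : Fin n → Fin n → MvPolynomial (NodePair n) ℝ :=
  fun u v => if h : u = v then 0 else MvPolynomial.X ⟨s(u, v), by simpa using h⟩ ^ deg

theorem eval_kernelPoly (I : SSLInstance n) (deg : ℕ) (α : ℝ) (u v : Fin n) :
    MvPolynomial.eval (fun e => I.sim e + α) (kernelPoly n deg u v) = I.polyKernel deg α u v := by
  unfold kernelPoly SSLInstance.polyKernel
  split_ifs <;> simp

open Classical in
/-- The polynomials in the similarities whose signs determine the predicted labels. -/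
noncomputable def labelingPolys (n deg : ℕ) : Finset (MvPolynomial (NodePair n) ℝ) :=
  (Finset.univ.image fun p : Fin n × Fin n => kernelPoly n deg p.1 p.2) ∪
  (Finset.univ.image fun y : Fin n → Option Bool => (harmonicMatrix (kernelPoly n deg) y).det) ∪
  Finset.univ.image fun p : (Fin n → Option Bool) × Fin n =>
    roundingDet (kernelPoly n deg) p.1 p.2

theorem kernelPoly_mem_labelingPolys (deg : ℕ) (u v : Fin n) :
    kernelPoly n deg u v ∈ labelingPolys n deg := by
  simp only [labelingPolys, Finset.mem_union, Finset.mem_image, Finset.mem_univ, true_and]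
  exact Or.inl (Or.inl ⟨(u, v), rfl⟩)

theorem det_mem_labelingPolys (deg : ℕ) (y : Fin n → Option Bool) :
    (harmonicMatrix (kernelPoly n deg) y).det ∈ labelingPolys n deg := by
  simp only [labelingPolys, Finset.mem_union, Finset.mem_image, Finset.mem_univ, true_and]
  exact Or.inl (Or.inr ⟨y, rfl⟩)

theorem roundingDet_mem_labelingPolys (deg : ℕ) (y : Fin n → Option Bool) (u : Fin n) :
    roundingDet (kernelPoly n deg) y u ∈ labelingPolys n deg := by
  simp only [labelingPolys, Finset.mem_union, Finset.mem_image, Finset.mem_univ, true_and]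
  exact Or.inr ⟨(y, u), rfl⟩

theorem SSLInstance.polyKernel_symm (I : SSLInstance n) (deg : ℕ) (α : ℝ) (u v : Fin n) :
    I.polyKernel deg α u v = I.polyKernel deg α v u := by
  unfold SSLInstance.polyKernel
  by_cases h : u = v
  · simp [h]
  · simp [h, Ne.symm h, Sym2.eq_swap]

theorem SSLInstance.polyKernel_self (I : SSLInstance n) (deg : ℕ) (α : ℝ) (v : Fin n) :
    I.polyKernel deg α v v = 0 := by
  simp [SSLInstance.polyKernel]

theorem SSLInstance.polyKernel_pos_of_no_crossing {I : SSLInstance n} {deg : ℕ} {α : ℝ}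
    (hw : ∀ u v, 0 ≤ I.polyKernel deg α u v)
    (hno : α ∉ diagonalCrossings (labelingPolys n deg) I.sim) (u v : Fin n) (huv : u ≠ v) :
    0 < I.polyKernel deg α u v := by
  refine lt_of_le_of_ne (hw u v) fun h => hno ⟨_, kernelPoly_mem_labelingPolys deg u v, ?_, ?_⟩
  · rw [eval_kernelPoly, h]
  -- At this parameter the base of the power is `1`, so the kernel polynomial does not vanish on the
  -- line, whatever the degree.
  · refine ⟨1 - I.sim ⟨s(u, v), by simpa using huv⟩, ?_⟩
    rw [eval_kernelPoly]
    simp [SSLInstance.polyKernel, huv]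

/-- Signs are carried from `ρ` to `ρ'` by the polynomials alone, so weights between the two
parameters may be negative; nonnegativity is needed only at the ends, where the signs are translated
into predictions. -/
theorem SSLInstance.loss_eq_of_no_crossing {I : SSLInstance n} {deg : ℕ} {ρ ρ' : ℝ}
    (ell : Bool → Bool → ℝ) (hlab : ∃ v, I.labeled v = true)
    (hw : ∀ u v, 0 ≤ I.polyKernel deg ρ u v) (hw' : ∀ u v, 0 ≤ I.polyKernel deg ρ' u v)
    (hno : ∀ α ∈ Set.uIcc ρ ρ', α ∉ diagonalCrossings (labelingPolys n deg) I.sim) :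
    I.loss ell deg ρ = I.loss ell deg ρ' := by
  have hy : ∃ v, (I.observed v).isSome := by
    obtain ⟨v, hv⟩ := hlab
    exact ⟨v, by simp [SSLInstance.observed, hv]⟩
  have hsign : ∀ α ∈ Set.uIcc ρ ρ', (∀ u v, 0 ≤ I.polyKernel deg α u v) → ∀ u,
      predictedLabels (I.polyKernel deg α) I.observed u = decide (0 ≤
        SignType.sign (MvPolynomial.eval (fun e => I.sim e + α)
          (harmonicMatrix (kernelPoly n deg) I.observed).det) *
        SignType.sign (MvPolynomial.eval (fun e => I.sim e + α)
          (roundingDet (kernelPoly n deg) I.observed u))) := by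
    intro α hα hw u
    have hpos := SSLInstance.polyKernel_pos_of_no_crossing hw (hno α hα)
    rw [map_det_harmonicMatrix, map_roundingDet]
    simp only [eval_kernelPoly]
    have hdet := det_harmonicMatrix_ne_zero hpos hy
    -- The test `1/2 ≤ f u` is multiplied by the positive number `det ^ 2`, so the sign of the
    -- determinant itself need not be known.
    rw [← det_mul_softLabels (fun u v => I.polyKernel_symm deg α u v)
      (I.polyKernel_self deg α) hpos hy u, ← sign_mul, ← mul_assoc, predictedLabels,
      decide_eq_decide, sign_nonneg_iff, mul_nonneg_iff_of_pos_left (mul_self_pos.2 hdet)]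
    exact ⟨fun h => by linarith, fun h => by linarith⟩
  have hpred : predictedLabels (I.polyKernel deg ρ) I.observed =
      predictedLabels (I.polyKernel deg ρ') I.observed := by
    funext u
    rw [hsign ρ Set.left_mem_uIcc hw, hsign ρ' Set.right_mem_uIcc hw',
      sign_eval_eq_of_no_crossing hno (det_mem_labelingPolys deg _),
      sign_eval_eq_of_no_crossing hno (roundingDet_mem_labelingPolys deg _ u)]
  rw [SSLInstance.loss, hpred, SSLInstance.loss]

theorem SSLInstance.loss_mem_Icc (I : SSLInstance n) {ell : Bool → Bool → ℝ}
    (hell : ∀ y y', ell y y' ∈ Set.Icc (0 : ℝ) 1) (deg : ℕ) (α : ℝ) :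
    I.loss ell deg α ∈ Set.Icc (0 : ℝ) 1 := by
  refine ⟨div_nonneg (Finset.sum_nonneg fun u _ => (hell _ _).1) (Nat.cast_nonneg _),
    div_le_one_of_le₀ ?_ (Nat.cast_nonneg _)⟩
  exact (Finset.sum_le_card_nsmul _ _ 1 fun u _ => (hell _ _).2).trans (by simp)

end NoCrossing

/-! ### Probability of a crossing in a short interval. -/

section GridCells

/-- The closed cell number `i` of the grid with origin `x` and mesh `h`. -/
def gridCell (x h : ℝ) (i : ℤ) : Set ℝ := Set.Icc (x + i * h) (x + (i + 1) * h)

/-- The cells are closed, so a grid point lies in two of them; this is the source of the factor `2`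
in the counts of cells. -/
theorem mem_gridCell_iff_floor {x h : ℝ} (hh : 0 < h) {i : ℤ} {α : ℝ} (hα : α ∈ gridCell x h i) :
    i = ⌊(α - x) / h⌋ ∨ i = ⌊(α - x) / h⌋ - 1 := by
  obtain ⟨h1, h2⟩ := hα
  have h3 : (i : ℝ) ≤ (α - x) / h := by rw [le_div_iff₀ hh]; linarith
  have h4 : (α - x) / h ≤ i + 1 := by rw [div_le_iff₀ hh]; linarith
  have h5 : i ≤ ⌊(α - x) / h⌋ := Int.le_floor.2 h3
  have h6 : ⌊(α - x) / h⌋ ≤ i + 1 := by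
    have := (Int.floor_le ((α - x) / h)).trans h4
    exact_mod_cast this
  omega

/-- A finite set meets at most twice as many cells as it has points. -/
theorem exists_finset_gridCells {D : Set ℝ} (hD : D.Finite) (x : ℝ) {h : ℝ} (hh : 0 < h) :
    ∃ S : Finset ℤ, S.card ≤ 2 * D.ncard ∧ ∀ i, (D ∩ gridCell x h i).Nonempty → i ∈ S := by
  classical
  refine ⟨(hD.toFinset.image fun α => ⌊(α - x) / h⌋) ∪
    hD.toFinset.image fun α => ⌊(α - x) / h⌋ - 1, ?_, ?_⟩
  · refine (Finset.card_union_le _ _).trans ?_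
    rw [Set.ncard_eq_toFinset_card D hD, two_mul]
    exact add_le_add Finset.card_image_le Finset.card_image_le
  · rintro i ⟨α, hα, hi⟩
    simp only [Finset.mem_union, Finset.mem_image, Set.Finite.mem_toFinset]
    exact (mem_gridCell_iff_floor hh hi).imp (fun h => ⟨α, hα, h.symm⟩) fun h => ⟨α, hα, h.symm⟩

variable {σ : Type*}

/-- The points `s` whose diagonal line crosses within the cell number `i`. -/
def crossingSet (F : Finset (MvPolynomial σ ℝ)) (x h : ℝ) (i : ℤ) : Set (σ → ℝ) :=
  {s | (diagonalCrossings F s ∩ gridCell x h i).Nonempty}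

theorem measurableSet_crossingSet [Finite σ] (F : Finset (MvPolynomial σ ℝ)) (x h : ℝ) (i : ℤ) :
    MeasurableSet (crossingSet F x h i) :=
  measurableSet_diagonalCrossings_inter_Icc F _ _

theorem exists_finset_crossingSet (F : Finset (MvPolynomial σ ℝ)) (x : ℝ) {h : ℝ} (hh : 0 < h)
    (s : σ → ℝ) : ∃ S : Finset ℤ, S.card ≤ 2 * ∑ q ∈ F, q.totalDegree ∧
      ∀ i, s ∈ crossingSet F x h i → i ∈ S := by
  obtain ⟨S, hS, hSi⟩ := exists_finset_gridCells (finite_diagonalCrossings F s) x hh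
  exact ⟨S, hS.trans (Nat.mul_le_mul_left 2 (ncard_diagonalCrossings_le F s)), hSi⟩

theorem tsum_indicator_crossingSet_le (F : Finset (MvPolynomial σ ℝ)) (x : ℝ) {h : ℝ} (hh : 0 < h)
    (s : σ → ℝ) : ∑' i, (crossingSet F x h i).indicator (1 : (σ → ℝ) → ℝ≥0∞) s ≤
      (2 * ∑ q ∈ F, q.totalDegree : ℕ) := by
  obtain ⟨S, hS, hSi⟩ := exists_finset_crossingSet F x hh s
  rw [tsum_eq_sum (s := S) fun i hi => Set.indicator_of_notMem (fun h => hi (hSi i h)) _]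
  calc ∑ i ∈ S, (crossingSet F x h i).indicator (1 : (σ → ℝ) → ℝ≥0∞) s ≤ ∑ i ∈ S, 1 :=
        Finset.sum_le_sum fun i _ => Set.indicator_le_self' (by simp) s
    _ = (S.card : ℝ≥0∞) := by simp
    _ ≤ _ := by exact_mod_cast hS

theorem tsum_measure_crossingSet_le [Finite σ] (F : Finset (MvPolynomial σ ℝ)) (x : ℝ)
    {h : ℝ} (hh : 0 < h) (ν : Measure (σ → ℝ)) :
    ∑' i, ν (crossingSet F x h i) ≤ (2 * ∑ q ∈ F, q.totalDegree : ℕ) * ν Set.univ := by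
  simp_rw [← lintegral_indicator_one (measurableSet_crossingSet F x h _)]
  rw [← lintegral_tsum fun i =>
    (measurable_one.indicator (measurableSet_crossingSet F x h i)).aemeasurable,
    ← lintegral_const]
  exact lintegral_mono fun s => tsum_indicator_crossingSet_le F x hh s

variable [Fintype σ]

/-- Within a bounded box, the points whose diagonal line crosses within a given interval of
length `h` have volume `O(h)`. -/
theorem volume_crossingSet_inter_box_le (F : Finset (MvPolynomial σ ℝ)) (M : ℝ) (x : ℝ) {h : ℝ}
    (hh : 0 < h) (hh1 : h ≤ 1) (i : ℤ) :
    volume (crossingSet F x h i ∩ {s | ∀ e, |s e| ≤ M}) ≤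
      ENNReal.ofReal h * ((4 * ∑ q ∈ F, q.totalDegree : ℕ) *
        volume (Set.Icc (fun _ : σ => -(M + 1)) fun _ => M + 1)) := by
  set N := ∑ q ∈ F, q.totalDegree
  set B : Set (σ → ℝ) := Set.Icc (fun _ => -(M + 1)) fun _ => M + 1 with hB
  set A := crossingSet F x h i ∩ {s | ∀ e, |s e| ≤ M}
  -- The number of translates used: `k * h ≤ 1` keeps them in the box enlarged by `1`, and `2 * h *
  -- k ≥ 1` turns division by `k` into a factor `2 * h`.
  set k := ⌊h⁻¹⌋₊ with hk
  have hinv : 1 ≤ h⁻¹ := (one_le_inv₀ hh).2 hh1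
  have hk1 : 1 ≤ k := Nat.le_floor (by simpa using hinv)
  have hkh : (k : ℝ) * h ≤ 1 := by
    have := Nat.floor_le (zero_le_one.trans hinv)
    calc (k : ℝ) * h ≤ h⁻¹ * h := by gcongr
      _ = 1 := inv_mul_cancel₀ hh.ne'
  have hk2 : 1 ≤ 2 * h * k := by
    have h1 : h⁻¹ < k + 1 := Nat.lt_floor_add_one _
    have h2 : (1 : ℝ) ≤ k := by exact_mod_cast hk1
    have h3 : h⁻¹ ≤ 2 * k := by linarith
    calc (1 : ℝ) = h⁻¹ * h := (inv_mul_cancel₀ hh.ne').symm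
      _ ≤ 2 * k * h := by gcongr
      _ = 2 * h * k := by ring
  -- Translation by `-j * h` along the diagonal moves a crossing from cell `i` to cell `i + j`.
  -- Summed over `j`, the right-hand sides total at most `2 * N * volume B`.
  have htrans : ∀ j ∈ Finset.range k, volume A ≤
      (volume.restrict B) (crossingSet F x h (i + j)) := by
    intro j hj
    have hjh : (j : ℝ) * h ≤ 1 := by
      refine le_trans ?_ hkh
      gcongr
      exact (Finset.mem_range.1 hj).le
    have hj0 : 0 ≤ (j : ℝ) * h := by positivity
    rw [Measure.restrict_apply (measurableSet_crossingSet F x h _),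
      ← measure_preimage_add_right volume (fun _ : σ => -((j : ℝ) * h))
        (crossingSet F x h (i + j) ∩ B)]
    refine measure_mono fun s hs => ?_
    obtain ⟨⟨α, hα, hi⟩, hbox⟩ := hs
    refine ⟨⟨α + j * h, ?_, ?_⟩, ?_⟩
    · have := (diagonalCrossings_add_const F s (-((j : ℝ) * h)) (α + j * h)).2
        (by simpa using hα)
      exact this
    · obtain ⟨h1, h2⟩ := hi
      constructor <;> push_cast <;> linarith
    · have := fun e => abs_le.1 (hbox e)
      constructor <;> intro e <;> simp only [Pi.add_apply] <;> linarith [(this e).1, (this e).2]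
  have hsum : (k : ℝ≥0∞) * volume A ≤ (2 * N : ℕ) * volume B := by
    calc (k : ℝ≥0∞) * volume A = ∑ j ∈ Finset.range k, volume A := by simp
      _ ≤ ∑ j ∈ Finset.range k, (volume.restrict B) (crossingSet F x h (i + j)) :=
        Finset.sum_le_sum htrans
      _ = ∑ i' ∈ (Finset.range k).map ⟨fun j : ℕ => i + j, fun a b hab => by simpa using hab⟩,
          (volume.restrict B) (crossingSet F x h i') := by rw [Finset.sum_map]; rfl
      _ ≤ ∑' i', (volume.restrict B) (crossingSet F x h i') := ENNReal.sum_le_tsum _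
      _ ≤ _ := tsum_measure_crossingSet_le F x hh _
      _ = _ := by rw [Measure.restrict_apply_univ]
  calc volume A = 1 * volume A := (one_mul _).symm
    _ ≤ ENNReal.ofReal (2 * h * k) * volume A := by
      gcongr
      exact ENNReal.one_le_ofReal.2 hk2
    _ = ENNReal.ofReal (2 * h) * (k * volume A) := by
      rw [ENNReal.ofReal_mul (by positivity), ENNReal.ofReal_natCast, mul_assoc]
    _ ≤ ENNReal.ofReal (2 * h) * ((2 * N : ℕ) * volume B) := by gcongr
    _ = _ := by
      rw [mul_comm 2 h, ENNReal.ofReal_mul hh.le, ENNReal.ofReal_ofNat]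
      push_cast
      ring

/-- The constant of `measure_crossingSet_le`. -/
noncomputable def crossingConst (F : Finset (MvPolynomial σ ℝ)) (κ : ℝ≥0) (M : ℝ) : ℝ :=
  1 + (κ * ((4 * ∑ q ∈ F, q.totalDegree : ℕ) *
    volume (Set.Icc (fun _ : σ => -(M + 1)) fun _ => M + 1)) : ℝ≥0∞).toReal

theorem measure_crossingSet_le (F : Finset (MvPolynomial σ ℝ)) {κ : ℝ≥0} {M : ℝ}
    {ν : Measure (σ → ℝ)} [IsProbabilityMeasure ν] (hν : IsBoundedDensity κ ν)
    (hM : ∀ᵐ s ∂ν, ∀ e, |s e| ≤ M) (x : ℝ) {h : ℝ} (hh : 0 < h) (i : ℤ) :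
    ν (crossingSet F x h i) ≤ ENNReal.ofReal (crossingConst F κ M * h) := by
  have hC : 1 ≤ crossingConst F κ M := le_add_of_nonneg_right ENNReal.toReal_nonneg
  -- Long cells are covered by the summand `1` in `crossingConst`.
  rcases le_total 1 h with h1 | h1
  · refine prob_le_one.trans (ENNReal.one_le_ofReal.2 ?_)
    nlinarith
  obtain ⟨g, -, hgκ, rfl⟩ := hν
  set ν := (volume : Measure (σ → ℝ)).withDensity g
  have hle : ν ≤ κ • volume := by
    refine (withDensity_mono (Filter.Eventually.of_forall hgκ)).trans_eq ?_
    rw [withDensity_const]; rfl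
  have hfin : (κ * ((4 * ∑ q ∈ F, q.totalDegree : ℕ) *
      volume (Set.Icc (fun _ : σ => -(M + 1)) fun _ => M + 1)) : ℝ≥0∞) ≠ ⊤ :=
    ENNReal.mul_ne_top ENNReal.coe_ne_top
      (ENNReal.mul_ne_top (ENNReal.natCast_ne_top _) isCompact_Icc.measure_ne_top)
  calc ν (crossingSet F x h i) = ν (crossingSet F x h i ∩ {s | ∀ e, |s e| ≤ M}) := by
        refine measure_congr ?_
        filter_upwards [hM] with s hs
        exact propext ⟨fun h => ⟨h, hs⟩, fun h => h.1⟩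
    _ ≤ κ * volume (crossingSet F x h i ∩ {s | ∀ e, |s e| ≤ M}) := hle _
    _ ≤ κ * (ENNReal.ofReal h * ((4 * ∑ q ∈ F, q.totalDegree : ℕ) *
        volume (Set.Icc (fun _ : σ => -(M + 1)) fun _ => M + 1))) := by
      gcongr
      exact volume_crossingSet_inter_box_le F M x hh h1 i
    _ = ENNReal.ofReal h * (κ * ((4 * ∑ q ∈ F, q.totalDegree : ℕ) *
        volume (Set.Icc (fun _ : σ => -(M + 1)) fun _ => M + 1))) := by ring
    _ ≤ ENNReal.ofReal h * ENNReal.ofReal (crossingConst F κ M) := by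
      gcongr
      rw [← ENNReal.ofReal_toReal hfin]
      exact ENNReal.ofReal_le_ofReal (le_add_of_nonneg_left zero_le_one)
    _ = _ := by rw [mul_comm, ← ENNReal.ofReal_mul (zero_le_one.trans hC)]

end GridCells

/-! ### Expected maximum of independent counts. -/

section MaxOfCounts

/-- The excess over `1` is bounded linearly in the `a t`; this is what allows summation over
infinitely many events. -/
theorem prod_one_add_le_one_add_sum_mul {a : ℕ → ℝ≥0∞} {c : ℝ≥0∞} (ha : ∀ t, 1 + a t ≤ c)
    (T : ℕ) : ∏ t ∈ Finset.range T, (1 + a t) ≤ 1 + (∑ t ∈ Finset.range T, a t) * c ^ T := by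
  have hc : 1 ≤ c := le_self_add.trans (ha 0)
  induction T with
  | zero => simp
  | succ T ih =>
    have hP : ∏ t ∈ Finset.range T, (1 + a t) ≤ c ^ T := by
      simpa using Finset.prod_le_pow_card (Finset.range T) (fun t => 1 + a t) c fun t _ => ha t
    rw [Finset.prod_range_succ, Finset.sum_range_succ, mul_add, mul_one, add_mul, ← add_assoc]
    have hcT : c ^ T ≤ c ^ (T + 1) := pow_le_pow_right₀ hc (Nat.le_succ T)
    calc _ ≤ 1 + (∑ t ∈ Finset.range T, a t) * c ^ T + c ^ T * a T := by gcongr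
      _ ≤ _ := by rw [mul_comm (c ^ T)]; gcongr

/-- The tangent line of `exp` at `0`, with `e < 3`. The base `3` matches the factors `1 + 2 *
indicator`, and subtracting `1` makes events that are never hit contribute nothing. -/
theorem le_add_exp_neg_mul_three_pow_sub_one (k : ℕ) {m : ℝ} (hm : 0 ≤ m) :
    (k : ℝ) ≤ m + Real.exp (-m) * (3 ^ k - 1) := by
  have h1 : (k : ℝ) - m + 1 ≤ Real.exp (k - m) := Real.add_one_le_exp _
  have h2 : Real.exp (k - m) ≤ Real.exp (-m) * 3 ^ k := by
    rw [sub_eq_neg_add, Real.exp_add, ← mul_one (k : ℝ), Real.exp_nat_mul]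
    gcongr
    exact Real.exp_one_lt_three.le
  have h3 : Real.exp (-m) ≤ 1 := Real.exp_le_one_iff.2 (by linarith)
  linarith

theorem prod_one_add_two_mul_indicator {α : Type*} (S : ℕ → α) (B : Set α) (T : ℕ) :
    ∏ t ∈ Finset.range T, (1 + 2 * B.indicator (1 : α → ℝ≥0∞) (S t)) =
      3 ^ {t : ℕ | t < T ∧ S t ∈ B}.ncard := by
  classical
  have h1 : ∀ t, 1 + 2 * B.indicator (1 : α → ℝ≥0∞) (S t) = if S t ∈ B then 3 else 1 := by
    intro t
    by_cases h : S t ∈ B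
    · simp only [h, Set.indicator_of_mem, Pi.one_apply, if_true]; norm_num
    · simp [h]
  have h2 : {t : ℕ | t < T ∧ S t ∈ B} = ↑((Finset.range T).filter fun t => S t ∈ B) := by
    ext; simp
  simp_rw [h1]
  rw [h2, Set.ncard_coe_finset, Finset.prod_ite, Finset.prod_const, Finset.prod_const_one, mul_one]

variable {Ω α : Type*} [MeasurableSpace Ω] {μ : Measure Ω} [IsProbabilityMeasure μ]
  [MeasurableSpace α]

/-- Independence factors the expectation into terms `1 + 2 * p t`, each at most `exp (2 * q)`. -/
theorem lintegral_prod_one_add_two_mul_indicator_sub_one_le {S : ℕ → Ω → α}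
    (hS : ∀ t, Measurable (S t)) (hind : iIndepFun S μ) {B : Set α} (hB : MeasurableSet B)
    {q : ℝ} (hq0 : 0 ≤ q) (hq : ∀ t, μ (S t ⁻¹' B) ≤ ENNReal.ofReal q) (T : ℕ) :
    ∫⁻ ω, (∏ t ∈ Finset.range T, (1 + 2 * B.indicator (1 : α → ℝ≥0∞) (S t ω)) - 1) ∂μ ≤
      (∑ t ∈ Finset.range T, 2 * μ (S t ⁻¹' B)) * ENNReal.ofReal (Real.exp (2 * q * T)) := by
  have hφ : Measurable fun s : α => 1 + 2 * B.indicator (1 : α → ℝ≥0∞) s :=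
    ((measurable_one.indicator hB).const_mul 2).const_add 1
  have hint : ∀ t, ∫⁻ ω, (1 + 2 * B.indicator (1 : α → ℝ≥0∞) (S t ω)) ∂μ =
      1 + 2 * μ (S t ⁻¹' B) := by
    intro t
    rw [lintegral_add_left measurable_const, lintegral_const_mul 2
      (f := fun ω => B.indicator (1 : α → ℝ≥0∞) (S t ω)) ((measurable_one.indicator hB).comp (hS t)),
      lintegral_one, measure_univ]
    congr 2
    rw [← lintegral_indicator_one (hS t hB)]
    rfl
  have hprod := lintegral_prod_eq_prod_lintegral_of_indepFun (μ := μ) (Finset.range T)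
    (fun t ω => 1 + 2 * B.indicator (1 : α → ℝ≥0∞) (S t ω))
    (hind.comp (fun _ s => 1 + 2 * B.indicator (1 : α → ℝ≥0∞) s) fun _ => hφ)
    fun t => hφ.comp (hS t)
  rw [lintegral_sub measurable_const (by simp), lintegral_one, measure_univ, hprod,
    tsub_le_iff_left]
  · simp_rw [hint]
    rw [mul_comm (2 * q), Real.exp_nat_mul,
      ENNReal.ofReal_pow (Real.exp_nonneg _)]
    refine prod_one_add_le_one_add_sum_mul (fun t => ?_) T
    calc 1 + 2 * μ (S t ⁻¹' B) ≤ 1 + 2 * ENNReal.ofReal q := by gcongr; exact hq t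
      _ = ENNReal.ofReal (1 + 2 * q) := by
        rw [ENNReal.ofReal_add zero_le_one (by positivity), ENNReal.ofReal_mul zero_le_two,
          ENNReal.ofReal_one, ENNReal.ofReal_ofNat]
      _ ≤ _ := ENNReal.ofReal_le_ofReal (by linarith [Real.add_one_le_exp (2 * q)])
  · refine Filter.Eventually.of_forall fun ω => ?_
    exact Finset.one_le_prod' fun t _ => le_self_add

/-- The expected maximum over a family of events of the number of independent samples that hit the
event, if no event is likely and no sample hits more than `N` events. -/
theorem exists_integrable_bound_of_counts {S : ℕ → Ω → α} (hS : ∀ t, Measurable (S t))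
    (hind : iIndepFun S μ) {B : ℤ → Set α} (hB : ∀ i, MeasurableSet (B i)) {q : ℝ} (hq0 : 0 ≤ q)
    (hq : ∀ t i, μ (S t ⁻¹' B i) ≤ ENNReal.ofReal q) {N : ℕ}
    (hN : ∀ s, ∑' i, (B i).indicator (1 : α → ℝ≥0∞) s ≤ N) {T : ℕ} (hT : 1 ≤ T) :
    ∃ g : Ω → ℝ, Integrable g μ ∧
      (∀ᵐ ω ∂μ, 0 ≤ g ω ∧ ∀ i, ({t : ℕ | t < T ∧ S t ω ∈ B i}.ncard : ℝ) ≤ g ω) ∧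
      ∫ ω, g ω ∂μ ≤ 2 * q * T + Real.log T + 2 * N := by
  set Y : ℤ → Ω → ℝ≥0∞ := fun i ω =>
    ∏ t ∈ Finset.range T, (1 + 2 * (B i).indicator (1 : α → ℝ≥0∞) (S t ω)) - 1 with hY
  have hYm : ∀ i, Measurable (Y i) := fun i => Measurable.sub_const
    (Finset.measurable_prod _ fun t _ =>
      (((measurable_one.indicator (hB i)).comp (hS t)).const_mul 2).const_add 1) 1
  set Z : Ω → ℝ≥0∞ := fun ω => ∑' i, Y i ω with hZ
  have hZm : Measurable Z := Measurable.tsum hYm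
  have hp : ∀ t, ∑' i, μ (S t ⁻¹' B i) ≤ N := by
    intro t
    simp_rw [← lintegral_indicator_one (hS t (hB _))]
    rw [← lintegral_tsum fun i => (measurable_one.indicator (hS t (hB i))).aemeasurable]
    calc _ ≤ ∫⁻ _, (N : ℝ≥0∞) ∂μ := lintegral_mono fun ω => hN (S t ω)
      _ = N := by simp
  have hZint : ∫⁻ ω, Z ω ∂μ ≤ ENNReal.ofReal (2 * N * T * Real.exp (2 * q * T)) := by
    rw [hZ, lintegral_tsum fun i => (hYm i).aemeasurable]
    calc ∑' i, ∫⁻ ω, Y i ω ∂μ ≤ ∑' i, (∑ t ∈ Finset.range T, 2 * μ (S t ⁻¹' B i)) *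
          ENNReal.ofReal (Real.exp (2 * q * T)) := ENNReal.tsum_le_tsum fun i =>
            lintegral_prod_one_add_two_mul_indicator_sub_one_le hS hind (hB i) hq0
              (fun t => hq t i) T
      _ = (∑ t ∈ Finset.range T, 2 * ∑' i, μ (S t ⁻¹' B i)) *
          ENNReal.ofReal (Real.exp (2 * q * T)) := by
        rw [ENNReal.tsum_mul_right, Summable.tsum_finsetSum fun _ _ => ENNReal.summable]
        simp_rw [ENNReal.tsum_mul_left]
      _ ≤ (∑ t ∈ Finset.range T, 2 * (N : ℝ≥0∞)) * ENNReal.ofReal (Real.exp (2 * q * T)) := by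
        gcongr with t _
        exact hp t
      _ = _ := by
        rw [ENNReal.ofReal_mul (by positivity), ENNReal.ofReal_mul (by positivity),
          ENNReal.ofReal_mul zero_le_two, ENNReal.ofReal_natCast, ENNReal.ofReal_natCast,
          ENNReal.ofReal_ofNat, Finset.sum_const, Finset.card_range, nsmul_eq_mul]
        ring
  have hZtop : ∫⁻ ω, Z ω ∂μ ≠ ⊤ := (hZint.trans_lt ENNReal.ofReal_lt_top).ne
  have hZi : Integrable (fun ω => (Z ω).toReal) μ :=
    integrable_toReal_of_lintegral_ne_top hZm.aemeasurable hZtop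
  have hT' : (1 : ℝ) ≤ T := by exact_mod_cast hT
  -- Chosen so that `exp (-m)` cancels the factor `T * exp (2 * q * T)` in the moment bound and
  -- leaves `2 * N`.
  set m := 2 * q * T + Real.log T with hm
  have hm0 : 0 ≤ m := add_nonneg (by positivity) (Real.log_nonneg hT')
  refine ⟨fun ω => m + Real.exp (-m) * (Z ω).toReal, (integrable_const m).add (hZi.const_mul _), ?_, ?_⟩
  · filter_upwards [ae_lt_top hZm hZtop] with ω hω
    refine ⟨by positivity, fun i => (le_add_exp_neg_mul_three_pow_sub_one _ hm0).trans ?_⟩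
    gcongr
    refine (ENNReal.ofReal_le_iff_le_toReal hω.ne).1 (le_trans (le_of_eq ?_) (ENNReal.le_tsum i))
    rw [hY]
    dsimp only
    rw [prod_one_add_two_mul_indicator, ENNReal.ofReal_sub _ zero_le_one,
      ENNReal.ofReal_pow (by norm_num), ENNReal.ofReal_ofNat, ENNReal.ofReal_one]
  · rw [integral_add (integrable_const _) (hZi.const_mul _), integral_const, integral_const_mul,
      integral_toReal hZm.aemeasurable (ae_lt_top hZm hZtop)]
    have h1 : (∫⁻ ω, Z ω ∂μ).toReal ≤ 2 * N * T * Real.exp (2 * q * T) :=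
      ENNReal.toReal_le_of_le_ofReal (by positivity) hZint
    have h2 : Real.exp (-m) * (2 * N * T * Real.exp (2 * q * T)) = 2 * N := by
      rw [hm, neg_add, Real.exp_add, Real.exp_neg, Real.exp_neg, Real.exp_log (by linarith)]
      field_simp
    have h3 := mul_le_mul_of_nonneg_left h1 (Real.exp_nonneg (-m))
    simp only [probReal_univ, one_smul]
    linarith

end MaxOfCounts

/-! ### From cell counts to dispersion. -/

section Dispersion

/-- Without boundedness the real `sSup` would take its default value `0` and bound nothing. -/
theorem bddAbove_nonLipschitz (P : Set ℝ) (L : ℝ) (l : ℕ → ℝ → ℝ) (T : ℕ) (ε : ℝ) :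
    BddAbove {x : ℝ | ∃ ρ ∈ P, ∃ ρ' ∈ P, |ρ - ρ'| ≤ ε ∧
      x = ({t : ℕ | t < T ∧ l t ρ - l t ρ' > L * |ρ - ρ'|}.ncard : ℝ)} := by
  refine ⟨T, ?_⟩
  rintro _ ⟨ρ, -, ρ', -, -, rfl⟩
  have h := Set.ncard_le_ncard (s := {t : ℕ | t < T ∧ l t ρ - l t ρ' > L * |ρ - ρ'|})
    (t := ↑(Finset.range T)) (fun t ht => by simpa using ht.1) (Finset.finite_toSet _)
  rw [Set.ncard_coe_finset, Finset.card_range] at h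
  exact_mod_cast h

/-- If the functions change only across their critical sets `D t`, then the number of
non-Lipschitz functions is controlled by the number of critical sets meeting a grid cell. -/
theorem maxNonLipschitz_le_two_mul {P : Set ℝ} {L : ℝ} (hL : 0 ≤ L) {l : ℕ → ℝ → ℝ}
    {D : ℕ → Set ℝ} (hD : ∀ t, ∀ ρ ∈ P, ∀ ρ' ∈ P, (∀ α ∈ Set.uIcc ρ ρ', α ∉ D t) → l t ρ = l t ρ')
    {T : ℕ} {ε : ℝ} (hε : 0 < ε) {G : ℝ} (hG0 : 0 ≤ G)
    (hG : ∀ i, ({t : ℕ | t < T ∧ (D t ∩ gridCell 0 ε i).Nonempty}.ncard : ℝ) ≤ G) :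
    maxNonLipschitz P L l T ε ≤ 2 * G := by
  refine Real.sSup_le ?_ (by positivity)
  rintro _ ⟨ρ, hρ, ρ', hρ', hdist, rfl⟩
  -- The cell of the smaller parameter; as the distance is at most `ε`, the cells `i` and `i + 1`
  -- cover the interval between the two.
  set i := ⌊min ρ ρ' / ε⌋ with hi
  have hi1 : (i : ℝ) * ε ≤ min ρ ρ' := (le_div_iff₀ hε).1 (Int.floor_le _)
  have hi2 : min ρ ρ' < (i + 1) * ε := (div_lt_iff₀ hε).1 (Int.lt_floor_add_one _)
  have hmax : max ρ ρ' ≤ min ρ ρ' + ε := by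
    rw [abs_sub_comm, ← max_sub_min_eq_abs] at hdist
    linarith
  have hfin : ∀ j, {t : ℕ | t < T ∧ (D t ∩ gridCell 0 ε j).Nonempty}.Finite := fun j =>
    (Set.finite_lt_nat T).subset fun t ht => ht.1
  have hsub : {t : ℕ | t < T ∧ l t ρ - l t ρ' > L * |ρ - ρ'|} ⊆
      {t : ℕ | t < T ∧ (D t ∩ gridCell 0 ε i).Nonempty} ∪
        {t : ℕ | t < T ∧ (D t ∩ gridCell 0 ε (i + 1)).Nonempty} := by
    rintro t ⟨htT, ht⟩
    have hne : l t ρ ≠ l t ρ' := fun h => by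
      rw [h, sub_self] at ht
      exact absurd ht (not_lt.2 (by positivity))
    have hex : ∃ α ∈ Set.uIcc ρ ρ', α ∈ D t := by
      by_contra! h
      exact hne (hD t ρ hρ ρ' hρ' h)
    obtain ⟨α, ⟨hα1, hα2⟩, hα⟩ := hex
    have h1 : min ρ ρ' ≤ α := hα1
    have h2 : α ≤ max ρ ρ' := hα2
    rcases le_total α ((i + 1) * ε) with h | h
    · exact Or.inl ⟨htT, α, hα, by constructor <;> linarith⟩
    · exact Or.inr ⟨htT, α, hα, by constructor <;> push_cast <;> linarith⟩
  have hcard := (Set.ncard_le_ncard hsub ((hfin i).union (hfin (i + 1)))).trans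
    (Set.ncard_union_le _ _)
  have : ({t : ℕ | t < T ∧ l t ρ - l t ρ' > L * |ρ - ρ'|}.ncard : ℝ) ≤
      ({t : ℕ | t < T ∧ (D t ∩ gridCell 0 ε i).Nonempty}.ncard : ℝ) +
        ({t : ℕ | t < T ∧ (D t ∩ gridCell 0 ε (i + 1)).Nonempty}.ncard : ℝ) := by
    exact_mod_cast hcard
  linarith [hG i, hG (i + 1)]

end Dispersion

/-! ### Regret of continuous exponential weights. -/

section ExponentialWeights

theorem expWeight_eq_exp (η : ℝ) (l : ℕ → ℝ → ℝ) (t : ℕ) (ρ : ℝ) :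
    expWeight η l t ρ = Real.exp (η * ∑ s ∈ Finset.range t, (1 - l s ρ)) := by
  induction t with
  | zero => simp [expWeight]
  | succ t ih => rw [expWeight, ih, ← Real.exp_add, Finset.sum_range_succ]; ring_nf

theorem expWeight_pos (η : ℝ) (l : ℕ → ℝ → ℝ) (t : ℕ) (ρ : ℝ) : 0 < expWeight η l t ρ := by
  rw [expWeight_eq_exp]
  exact Real.exp_pos _

variable {a b η : ℝ} {l : ℕ → ℝ → ℝ}

theorem aemeasurable_expWeight (hlm : ∀ t, AEMeasurable (l t) (volume.restrict (Set.Icc a b)))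
    (t : ℕ) : AEMeasurable (expWeight η l t) (volume.restrict (Set.Icc a b)) := by
  have h : expWeight η l t = fun ρ => Real.exp (η * ∑ s ∈ Finset.range t, (1 - l s ρ)) :=
    funext fun ρ => expWeight_eq_exp η l t ρ
  rw [h]
  exact ((Finset.aemeasurable_fun_sum _ fun s _ => (hlm s).const_sub 1).const_mul η).exp

theorem integrable_mul_expWeight (hη : 0 ≤ η) (hl : ∀ t ρ, l t ρ ∈ Set.Icc (0 : ℝ) 1)
    (hlm : ∀ t, AEMeasurable (l t) (volume.restrict (Set.Icc a b))) {f : ℝ → ℝ}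
    (hf : AEMeasurable f (volume.restrict (Set.Icc a b))) (hf1 : ∀ ρ, f ρ ∈ Set.Icc (0 : ℝ) 1)
    (t : ℕ) : IntegrableOn (fun ρ => f ρ * expWeight η l t ρ) (Set.Icc a b) := by
  refine Integrable.of_bound (hf.mul (aemeasurable_expWeight hlm t)).aestronglyMeasurable
    (Real.exp (η * t)) (Filter.Eventually.of_forall fun ρ => ?_)
  rw [Real.norm_eq_abs, abs_of_nonneg (mul_nonneg (hf1 ρ).1 (expWeight_pos η l t ρ).le)]
  refine (mul_le_of_le_one_left (expWeight_pos η l t ρ).le (hf1 ρ).2).trans ?_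
  rw [expWeight_eq_exp]
  have : ∑ s ∈ Finset.range t, (1 - l s ρ) ≤ t := by
    refine (Finset.sum_le_card_nsmul _ _ 1 fun s _ => ?_).trans (by simp)
    linarith [(hl s ρ).1]
  gcongr

theorem integrable_expWeight (hη : 0 ≤ η) (hl : ∀ t ρ, l t ρ ∈ Set.Icc (0 : ℝ) 1)
    (hlm : ∀ t, AEMeasurable (l t) (volume.restrict (Set.Icc a b))) (t : ℕ) :
    IntegrableOn (expWeight η l t) (Set.Icc a b) := by
  simpa using integrable_mul_expWeight hη hl hlm (f := fun _ => 1) aemeasurable_const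
    (fun _ => by simp) t

theorem integral_expWeight_pos (hab : a < b) (hη : 0 ≤ η)
    (hl : ∀ t ρ, l t ρ ∈ Set.Icc (0 : ℝ) 1)
    (hlm : ∀ t, AEMeasurable (l t) (volume.restrict (Set.Icc a b))) (t : ℕ) :
    0 < ∫ x in Set.Icc a b, expWeight η l t x := by
  rw [setIntegral_pos_iff_support_of_nonneg_ae
    (Filter.Eventually.of_forall fun ρ => (expWeight_pos η l t ρ).le)
    (integrable_expWeight hη hl hlm t)]
  have : Function.support (expWeight η l t) = Set.univ :=
    Function.support_eq_univ fun ρ => (expWeight_pos η l t ρ).ne'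
  rw [this, Set.univ_inter, Real.volume_Icc]
  exact ENNReal.ofReal_pos.2 (by linarith)

theorem isProbabilityMeasure_samplingLaw (hab : a < b) (hη : 0 ≤ η)
    (hl : ∀ t ρ, l t ρ ∈ Set.Icc (0 : ℝ) 1)
    (hlm : ∀ t, AEMeasurable (l t) (volume.restrict (Set.Icc a b))) (t : ℕ) :
    IsProbabilityMeasure (samplingLaw (Set.Icc a b) η l t) := by
  have hW := integral_expWeight_pos hab hη hl hlm t
  refine ⟨?_⟩
  rw [samplingLaw, withDensity_apply _ MeasurableSet.univ, Measure.restrict_univ,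
    ← ofReal_integral_eq_lintegral_ofReal ((integrable_expWeight hη hl hlm t).div_const _)
      (Filter.Eventually.of_forall fun ρ => div_nonneg (expWeight_pos η l t ρ).le hW.le),
    integral_div, div_self hW.ne', ENNReal.ofReal_one]

theorem integral_samplingLaw (hab : a < b) (hη : 0 ≤ η)
    (hl : ∀ t ρ, l t ρ ∈ Set.Icc (0 : ℝ) 1)
    (hlm : ∀ t, AEMeasurable (l t) (volume.restrict (Set.Icc a b))) (t : ℕ) (f : ℝ → ℝ) :
    ∫ ρ, f ρ ∂(samplingLaw (Set.Icc a b) η l t) =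
      (∫ ρ in Set.Icc a b, f ρ * expWeight η l t ρ) / ∫ ρ in Set.Icc a b, expWeight η l t ρ := by
  have hW := integral_expWeight_pos hab hη hl hlm t
  rw [samplingLaw, integral_withDensity_eq_integral_toReal_smul₀
    ((aemeasurable_expWeight hlm t).div_const _).ennreal_ofReal
    (Filter.Eventually.of_forall fun _ => ENNReal.ofReal_lt_top), ← integral_div]
  refine integral_congr_ae (Filter.Eventually.of_forall fun ρ => ?_)
  dsimp only
  rw [ENNReal.toReal_ofReal (div_nonneg (expWeight_pos η l t ρ).le hW.le), smul_eq_mul]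
  ring

theorem aemeasurable_samplingLaw {f : ℝ → ℝ}
    (hf : AEMeasurable f (volume.restrict (Set.Icc a b))) (t : ℕ) :
    AEMeasurable f (samplingLaw (Set.Icc a b) η l t) :=
  hf.mono_ac (withDensity_absolutelyContinuous _ _)

theorem integrable_samplingLaw (hab : a < b) (hη : 0 ≤ η)
    (hl : ∀ t ρ, l t ρ ∈ Set.Icc (0 : ℝ) 1)
    (hlm : ∀ t, AEMeasurable (l t) (volume.restrict (Set.Icc a b))) (t s : ℕ) :
    Integrable (l s) (samplingLaw (Set.Icc a b) η l t) := by
  have := isProbabilityMeasure_samplingLaw hab hη hl hlm t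
  refine Integrable.of_bound (aemeasurable_samplingLaw (hlm s) t).aestronglyMeasurable 1
    (Filter.Eventually.of_forall fun ρ => ?_)
  rw [Real.norm_eq_abs, abs_of_nonneg (hl s ρ).1]
  exact (hl s ρ).2

/-- From `exp x ≤ 1 + x + x ^ 2` for `|x| ≤ 1` and `u ^ 2 ≤ u` on `[0,1]`, the growth factor is
linear in the utility `u`, so its mean under the sampling law is explicit. -/
theorem integral_expWeight_succ_le (hab : a < b) (hη : 0 ≤ η) (hη1 : η ≤ 1)
    (hl : ∀ t ρ, l t ρ ∈ Set.Icc (0 : ℝ) 1)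
    (hlm : ∀ t, AEMeasurable (l t) (volume.restrict (Set.Icc a b))) (t : ℕ) :
    ∫ x in Set.Icc a b, expWeight η l (t + 1) x ≤ (∫ x in Set.Icc a b, expWeight η l t x) *
      Real.exp ((η + η ^ 2) * (1 - ∫ ρ, l t ρ ∂(samplingLaw (Set.Icc a b) η l t))) := by
  have hW := integral_expWeight_pos hab hη hl hlm t
  have hwi := integrable_expWeight hη hl hlm t
  have hlwi := integrable_mul_expWeight hη hl hlm (hlm t) (hl t) t
  set W := ∫ x in Set.Icc a b, expWeight η l t x with hWdef
  have hbound : ∀ ρ, expWeight η l (t + 1) ρ ≤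
      (1 + (η + η ^ 2)) * expWeight η l t ρ - (η + η ^ 2) * (l t ρ * expWeight η l t ρ) := by
    intro ρ
    have hu0 : 0 ≤ 1 - l t ρ := by linarith [(hl t ρ).2]
    have hu1 : 1 - l t ρ ≤ 1 := by linarith [(hl t ρ).1]
    set u := 1 - l t ρ with hu
    have hx : |η * u| ≤ 1 := by
      rw [abs_of_nonneg (mul_nonneg hη hu0)]
      exact mul_le_one₀ hη1 hu0 hu1
    have h1 := (abs_le.1 (Real.abs_exp_sub_one_sub_id_le hx)).2
    have h2 : Real.exp (η * u) ≤ 1 + (η + η ^ 2) * u := by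
      have : (η * u) ^ 2 ≤ η ^ 2 * u := by
        rw [mul_pow]
        exact mul_le_mul_of_nonneg_left (by nlinarith) (sq_nonneg η)
      linarith
    calc expWeight η l (t + 1) ρ = Real.exp (η * u) * expWeight η l t ρ := rfl
      _ ≤ (1 + (η + η ^ 2) * u) * expWeight η l t ρ :=
        mul_le_mul_of_nonneg_right h2 (expWeight_pos η l t ρ).le
      _ = _ := by rw [hu]; ring
  calc ∫ x in Set.Icc a b, expWeight η l (t + 1) x
      ≤ ∫ x in Set.Icc a b,
        ((1 + (η + η ^ 2)) * expWeight η l t x - (η + η ^ 2) * (l t x * expWeight η l t x)) :=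
        integral_mono (integrable_expWeight hη hl hlm (t + 1))
          ((hwi.const_mul _).sub (hlwi.const_mul _)) hbound
    _ = W * ((η + η ^ 2) * (1 - ∫ ρ, l t ρ ∂(samplingLaw (Set.Icc a b) η l t)) + 1) := by
      rw [integral_sub (hwi.const_mul _) (hlwi.const_mul _), integral_const_mul,
        integral_const_mul, integral_samplingLaw hab hη hl hlm, ← hWdef]
      field_simp
      ring
    _ ≤ _ := mul_le_mul_of_nonneg_left (Real.add_one_le_exp _) hW.le

theorem integral_expWeight_le (hab : a < b) (hη : 0 ≤ η) (hη1 : η ≤ 1)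
    (hl : ∀ t ρ, l t ρ ∈ Set.Icc (0 : ℝ) 1)
    (hlm : ∀ t, AEMeasurable (l t) (volume.restrict (Set.Icc a b))) (T : ℕ) :
    ∫ x in Set.Icc a b, expWeight η l T x ≤ (b - a) * Real.exp ((η + η ^ 2) *
      ∑ t ∈ Finset.range T, (1 - ∫ ρ, l t ρ ∂(samplingLaw (Set.Icc a b) η l t))) := by
  induction T with
  | zero => simp [expWeight, hab.le]
  | succ T ih =>
    refine (integral_expWeight_succ_le hab hη hη1 hl hlm T).trans ?_
    rw [Finset.sum_range_succ, mul_add, Real.exp_add, ← mul_assoc]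
    gcongr

/-- The total weight is at most exponential in the algorithm's utility, and at least the weight of
an interval of length `ε` on which every parameter is nearly as good as `r`. Comparing logarithms
gives the bound. -/
theorem sum_integral_samplingLaw_sub_le (hab : a < b) (hη : 0 < η) (hη1 : η ≤ 1)
    (hl : ∀ t ρ, l t ρ ∈ Set.Icc (0 : ℝ) 1)
    (hlm : ∀ t, AEMeasurable (l t) (volume.restrict (Set.Icc a b))) (T : ℕ) {ε m : ℝ}
    (hε : 0 < ε) (hεab : ε ≤ b - a) {r : ℝ} (hr : r ∈ Set.Icc a b)
    (hm : ∀ ρ ∈ Set.Icc a b, |ρ - r| ≤ ε →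
      ∑ t ∈ Finset.range T, l t ρ ≤ ∑ t ∈ Finset.range T, l t r + m) :
    ∑ t ∈ Finset.range T, ∫ ρ, l t ρ ∂(samplingLaw (Set.Icc a b) η l t) -
      ∑ t ∈ Finset.range T, l t r ≤ m + Real.log ((b - a) / ε) / η + η * T := by
  set S := ∑ t ∈ Finset.range T, ∫ ρ, l t ρ ∂(samplingLaw (Set.Icc a b) η l t) with hS
  set R := ∑ t ∈ Finset.range T, l t r with hR
  have hS0 : 0 ≤ S := Finset.sum_nonneg fun t _ => integral_nonneg fun ρ => (hl t ρ).1
  have hup := integral_expWeight_le hab hη.le hη1 hl hlm T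
  rw [Finset.sum_sub_distrib, ← hS] at hup
  simp only [Finset.sum_const, Finset.card_range, nsmul_eq_mul, mul_one] at hup
  -- Left end of an interval of length `ε` that contains `r` and stays inside `[a, b]` even when `r`
  -- is near `b`.
  set c := min r (b - ε) with hc
  have hca : a ≤ c := le_min hr.1 (by linarith)
  have hcr : c ≤ r := min_le_left _ _
  have hcb : c + ε ≤ b := by linarith [min_le_right r (b - ε)]
  have hrc : r ≤ c + ε := by
    rcases min_choice r (b - ε) with h | h <;> rw [hc, h]
    · linarith
    · linarith [hr.2]
  have hsub : Set.Icc c (c + ε) ⊆ Set.Icc a b := Set.Icc_subset_Icc hca hcb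
  have hlow : ε * Real.exp (η * (T - R - m)) ≤ ∫ x in Set.Icc a b, expWeight η l T x := by
    have hwi := integrable_expWeight hη.le hl hlm T
    calc ε * Real.exp (η * (T - R - m)) = ∫ _ in Set.Icc c (c + ε), Real.exp (η * (T - R - m)) := by
          rw [setIntegral_const, Real.volume_real_Icc_of_le (by linarith), smul_eq_mul,
            add_sub_cancel_left]
      _ ≤ ∫ x in Set.Icc c (c + ε), expWeight η l T x := by
          refine setIntegral_mono_on (integrableOn_const (by simp)) (hwi.mono_set hsub)
            measurableSet_Icc fun ρ hρ => ?_
          have := hm ρ (hsub hρ) (abs_le.2 ⟨by linarith [hρ.1], by linarith [hρ.2]⟩)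
          rw [expWeight_eq_exp, Finset.sum_sub_distrib]
          simp only [Finset.sum_const, Finset.card_range, nsmul_eq_mul, mul_one]
          exact Real.exp_le_exp.2 (mul_le_mul_of_nonneg_left (by linarith) hη.le)
      _ ≤ _ := setIntegral_mono_set hwi
          (Filter.Eventually.of_forall fun ρ => (expWeight_pos η l T ρ).le) hsub.eventuallyLE
  have hba : 0 < b - a := sub_pos.2 hab
  have hlog := Real.log_le_log (by positivity) (hlow.trans hup)
  rw [Real.log_mul hε.ne' (Real.exp_pos _).ne', Real.log_mul hba.ne' (Real.exp_pos _).ne',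
    Real.log_exp, Real.log_exp] at hlog
  have h1 : η * (S - R) ≤ η * m + Real.log ((b - a) / ε) + η ^ 2 * T := by
    rw [Real.log_div hba.ne' hε.ne']
    nlinarith [mul_nonneg (sq_nonneg η) hS0]
  have h2 : η * (m + Real.log ((b - a) / ε) / η + η * T) =
      η * m + Real.log ((b - a) / ε) + η ^ 2 * T := by
    field_simp
  exact le_of_mul_le_mul_left (h1.trans_eq h2.symm) hη

theorem isProbabilityMeasure_outputLaw (hab : a < b) (hη : 0 ≤ η)
    (hl : ∀ t ρ, l t ρ ∈ Set.Icc (0 : ℝ) 1)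
    (hlm : ∀ t, AEMeasurable (l t) (volume.restrict (Set.Icc a b))) (T : ℕ) :
    IsProbabilityMeasure (outputLaw (Set.Icc a b) η l T) := by
  have := fun t => isProbabilityMeasure_samplingLaw hab hη hl hlm t
  unfold outputLaw
  infer_instance

theorem integrable_sum_outputLaw (hab : a < b) (hη : 0 ≤ η)
    (hl : ∀ t ρ, l t ρ ∈ Set.Icc (0 : ℝ) 1)
    (hlm : ∀ t, AEMeasurable (l t) (volume.restrict (Set.Icc a b))) (T : ℕ) (t : Fin T) :
    Integrable (fun ρ : Fin T → ℝ => l t (ρ t)) (outputLaw (Set.Icc a b) η l T) := by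
  have := fun t => isProbabilityMeasure_samplingLaw hab hη hl hlm t
  exact integrable_comp_eval (μ := fun t : Fin T => samplingLaw (Set.Icc a b) η l t)
    (integrable_samplingLaw hab hη hl hlm t t)

theorem integrable_regret (hab : a < b) (hη : 0 ≤ η)
    (hl : ∀ t ρ, l t ρ ∈ Set.Icc (0 : ℝ) 1)
    (hlm : ∀ t, AEMeasurable (l t) (volume.restrict (Set.Icc a b))) (T : ℕ) :
    Integrable (regret (Set.Icc a b) l T) (outputLaw (Set.Icc a b) η l T) := by
  have := isProbabilityMeasure_outputLaw hab hη hl hlm T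
  exact (integrable_finsetSum _ fun t _ => integrable_sum_outputLaw hab hη hl hlm T t).sub
    (integrable_const _)

/-- Each summand depends on one coordinate, so only the marginals of the product law enter. -/
theorem integral_regret (hab : a < b) (hη : 0 ≤ η)
    (hl : ∀ t ρ, l t ρ ∈ Set.Icc (0 : ℝ) 1)
    (hlm : ∀ t, AEMeasurable (l t) (volume.restrict (Set.Icc a b))) (T : ℕ) :
    ∫ ρ, regret (Set.Icc a b) l T ρ ∂(outputLaw (Set.Icc a b) η l T) =
      ∑ t ∈ Finset.range T, ∫ ρ, l t ρ ∂(samplingLaw (Set.Icc a b) η l t) -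
        sInf ((fun r => ∑ t ∈ Finset.range T, l t r) '' Set.Icc a b) := by
  have hprob := fun t => isProbabilityMeasure_samplingLaw hab hη hl hlm t
  have := isProbabilityMeasure_outputLaw hab hη hl hlm T
  have hi := integrable_sum_outputLaw hab hη hl hlm T
  unfold regret
  rw [integral_sub (integrable_finsetSum _ fun t _ => hi t) (integrable_const _),
    integral_finsetSum _ fun t _ => hi t, integral_const, probReal_univ, one_smul,
    ← Fin.sum_univ_eq_sum_range fun t => ∫ ρ, l t ρ ∂(samplingLaw (Set.Icc a b) η l t)]
  congr 1
  · refine Finset.sum_congr rfl fun t _ => ?_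
    exact integral_comp_eval (μ := fun t : Fin T => samplingLaw (Set.Icc a b) η l t)
      (aemeasurable_samplingLaw (hlm t) t).aestronglyMeasurable
  · simp_rw [← Fin.sum_univ_eq_sum_range fun t => l t _]

/-- The regret of exponential weights is controlled by the dispersion of the losses. -/
theorem integral_regret_le (hab : a < b) (hη : 0 < η) (hη1 : η ≤ 1)
    (hl : ∀ t ρ, l t ρ ∈ Set.Icc (0 : ℝ) 1)
    (hlm : ∀ t, AEMeasurable (l t) (volume.restrict (Set.Icc a b))) (T : ℕ) {P : Set ℝ}
    (hP : Set.Icc a b ⊆ P) {ε : ℝ} (hε : 0 < ε) :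
    ∫ ρ, regret (Set.Icc a b) l T ρ ∂(outputLaw (Set.Icc a b) η l T) ≤
      maxNonLipschitz P 0 l T ε + Real.log ((b - a) / min ε (b - a)) / η + η * T := by
  rw [integral_regret hab hη.le hl hlm, sub_le_comm]
  refine le_csInf ((Set.nonempty_Icc.2 hab.le).image _) ?_
  rintro _ ⟨r, hr, rfl⟩
  rw [sub_le_comm]
  refine sum_integral_samplingLaw_sub_le hab hη hη1 hl hlm T (lt_min hε (sub_pos.2 hab))
    (min_le_right _ _) hr fun ρ hρ hdist => ?_
  -- For `L = 0` the counted rounds are those in which `ρ` loses more than `r`; each costs at most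
  -- `1`, all others nothing.
  have hcount : ({t : ℕ | t < T ∧ l t ρ - l t r > 0 * |ρ - r|}.ncard : ℝ) ≤
      maxNonLipschitz P 0 l T ε :=
    le_csSup (bddAbove_nonLipschitz P 0 l T ε)
      ⟨ρ, hP hρ, r, hP hr, hdist.trans (min_le_left _ _), rfl⟩
  refine le_trans ?_ (add_le_add_right hcount _)
  classical
  have hset : {t : ℕ | t < T ∧ l t ρ - l t r > 0 * |ρ - r|} =
      ↑((Finset.range T).filter fun t => l t r < l t ρ) := by
    ext; simp
  rw [hset, Set.ncard_coe_finset, Finset.card_filter, Nat.cast_sum, ← Finset.sum_add_distrib]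
  refine Finset.sum_le_sum fun t _ => ?_
  split_ifs with h
  · push_cast
    linarith [(hl t ρ).2, (hl t r).1]
  · simpa using h

end ExponentialWeights

/-! ### Assembly for the random instances. -/

section Assembly

variable {n : ℕ}

theorem SSLInstance.measurable_sim : Measurable (fun I : SSLInstance n => I.sim) :=
  (measurable_snd.comp measurable_snd).comp (comap_measurable _)

/-- The function is locally constant on the open set `Ioo a b \ D`, which has full measure in the
interval. -/
theorem aemeasurable_of_finite_critical_set {a b : ℝ} {f : ℝ → ℝ} {D : Set ℝ} (hD : D.Finite)
    (hf : ∀ ρ ∈ Set.Icc a b, ∀ ρ' ∈ Set.Icc a b, (∀ α ∈ Set.uIcc ρ ρ', α ∉ D) → f ρ = f ρ') :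
    AEMeasurable f (volume.restrict (Set.Icc a b)) := by
  have hopen : IsOpen (Set.Ioo a b \ D) := isOpen_Ioo.sdiff hD.isClosed
  have hcont : ContinuousOn f (Set.Ioo a b \ D) := by
    intro ρ hρ
    refine ContinuousAt.continuousWithinAt ?_
    obtain ⟨δ, hδ, hball⟩ := Metric.isOpen_iff.1 hopen ρ hρ
    refine continuousAt_const.congr (f := fun _ => f ρ) ?_
    filter_upwards [Metric.ball_mem_nhds ρ hδ] with ρ' hρ'
    refine hf ρ (Set.Ioo_subset_Icc_self hρ.1) ρ' (Set.Ioo_subset_Icc_self (hball hρ').1)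
      fun α hα => (hball ?_).2
    exact ((convex_ball ρ δ).ordConnected.uIcc_subset (Metric.mem_ball_self hδ) hρ') hα
  have hae : (Set.Icc a b : Set ℝ) =ᵐ[volume] (Set.Ioo a b \ D : Set ℝ) :=
    Ioo_ae_eq_Icc.symm.trans (sdiff_null_ae_eq_self (hD.measure_zero _)).symm
  rw [Measure.restrict_congr_set hae]
  exact hcont.aemeasurable hopen.measurableSet

theorem log_div_min_le {c ε : ℝ} (hc : 0 < c) (hε : 0 < ε) (hε1 : ε ≤ 1) :
    Real.log (c / min ε c) ≤ |Real.log c| - Real.log ε := by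
  have hlog : Real.log ε ≤ 0 := Real.log_nonpos hε.le hε1
  rcases le_total ε c with h | h
  · rw [min_eq_left h, Real.log_div hc.ne' hε.ne']
    linarith [le_abs_self (Real.log c)]
  · rw [min_eq_right h, div_self hc.ne', Real.log_one]
    linarith [abs_nonneg (Real.log c)]

/-- The loss function of an instance is well-behaved: it lies in the scope of
`SSLInstance.loss_eq_of_no_crossing` on `P`. -/
def SSLInstance.IsRegularOn (I : SSLInstance n) (deg : ℕ) (P : Set ℝ) : Prop :=
  (∃ v, I.labeled v = true) ∧ ∀ α ∈ P, ∀ u v, 0 ≤ I.polyKernel deg α u v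

theorem SSLInstance.IsRegularOn.loss_eq {I : SSLInstance n} {deg : ℕ} {P : Set ℝ}
    (hI : I.IsRegularOn deg P) (ell : Bool → Bool → ℝ) {ρ ρ' : ℝ} (hρ : ρ ∈ P) (hρ' : ρ' ∈ P)
    (hno : ∀ α ∈ Set.uIcc ρ ρ', α ∉ diagonalCrossings (labelingPolys n deg) I.sim) :
    I.loss ell deg ρ = I.loss ell deg ρ' :=
  SSLInstance.loss_eq_of_no_crossing ell hI.1 (hI.2 ρ hρ) (hI.2 ρ' hρ') hno

theorem isDispersedWith_loss {Ω : Type*} [MeasurableSpace Ω] {μ : Measure Ω}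
    [IsProbabilityMeasure μ] {deg : ℕ} {κ : ℝ≥0} {M : ℝ} {P : Set ℝ} (ell : Bool → Bool → ℝ)
    {I : ℕ → Ω → SSLInstance n} (hI : ∀ t, Measurable (I t)) (hind : iIndepFun I μ)
    (hreg : ∀ᵐ ω ∂μ, ∀ t, (I t ω).IsRegularOn deg P)
    (hdens : ∀ t, IsBoundedDensity κ (μ.map fun ω => (I t ω).sim))
    (hM : ∀ t, ∀ᵐ ω ∂μ, ∀ e, |(I t ω).sim e| ≤ M) {L : ℝ} (hL : 0 ≤ L) :
    IsDispersedWith μ P (1 / 2) L (4 * crossingConst (labelingPolys n deg) κ M + 2 +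
      8 * (∑ q ∈ labelingPolys n deg, q.totalDegree : ℕ)) 1 (fun t ω => (I t ω).loss ell deg) := by
  intro T hT ε hε
  set F := labelingPolys n deg
  set c := crossingConst F κ M with hc
  have hc1 : 1 ≤ c := le_add_of_nonneg_right ENNReal.toReal_nonneg
  have hT1 : (1 : ℝ) ≤ T := by exact_mod_cast hT
  have hT0 : (0 : ℝ) < T := by linarith
  have hε0 : 0 < ε := (Real.rpow_pos_of_pos hT0 _).trans_le hε
  -- The only use of `ε ≥ T^(-1/2)`, apart from positivity: the additive terms in `log T` and `N`
  -- are absorbed into `ε * T * (1 + log T)`.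
  have hεT : 1 ≤ ε * T := by
    calc (1 : ℝ) ≤ (T : ℝ) ^ (1 / 2 : ℝ) := Real.one_le_rpow hT1 (by norm_num)
      _ = (T : ℝ) ^ (-(1 / 2) : ℝ) * T := by
        nth_rewrite 3 [← Real.rpow_one (T : ℝ)]
        rw [← Real.rpow_add hT0]
        norm_num
      _ ≤ ε * T := by gcongr
  have hlog : 0 ≤ Real.log T := Real.log_nonneg hT1
  have hS : ∀ t, Measurable fun ω => (I t ω).sim := fun t =>
    SSLInstance.measurable_sim.comp (hI t)
  have hindS : iIndepFun (fun t ω => (I t ω).sim) μ :=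
    hind.comp (fun _ J => J.sim) fun _ => SSLInstance.measurable_sim
  have hq : ∀ t i, μ ((fun ω => (I t ω).sim) ⁻¹' crossingSet F 0 ε i) ≤
      ENNReal.ofReal (c * ε) := by
    intro t i
    have := Measure.isProbabilityMeasure_map (μ := μ) (hS t).aemeasurable
    rw [← Measure.map_apply (hS t) (measurableSet_crossingSet F 0 ε i)]
    refine measure_crossingSet_le F (hdens t) ?_ 0 hε0 i
    refine (ae_map_iff (hS t).aemeasurable ?_).2 (hM t)
    rw [Set.ofPred_forall]
    exact MeasurableSet.iInter fun e =>
      measurableSet_le (measurable_pi_apply e).abs measurable_const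
  obtain ⟨g, hgi, hg, hgint⟩ := exists_integrable_bound_of_counts hS hindS
    (measurableSet_crossingSet F 0 ε) (by positivity) hq
    (tsum_indicator_crossingSet_le F 0 hε0) hT
  refine ⟨fun ω => 2 * g ω, hgi.const_mul 2, ?_, ?_⟩
  · filter_upwards [hg, hreg] with ω hω hωr
    exact maxNonLipschitz_le_two_mul hL (D := fun t => diagonalCrossings F (I t ω).sim)
      (fun t ρ hρ ρ' hρ' hno => (hωr t).loss_eq ell hρ hρ' hno) hε0 hω.1 hω.2
  · rw [integral_const_mul, pow_one]
    push_cast at hgint ⊢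
    set N := ∑ q ∈ F, (q.totalDegree : ℝ)
    have hN : 0 ≤ N := Finset.sum_nonneg fun q _ => Nat.cast_nonneg _
    have h1 : ε * T ≤ ε * T * (1 + Real.log T) := le_mul_of_one_le_right (by linarith) (by linarith)
    have h2 : Real.log T ≤ ε * T * (1 + Real.log T) := by nlinarith
    have h3 : 1 ≤ ε * T * (1 + Real.log T) := hεT.trans h1
    calc 2 * ∫ ω, g ω ∂μ ≤ 4 * c * (ε * T) + 2 * Real.log T + 8 * N * 1 := by linarith
      _ ≤ 4 * c * (ε * T * (1 + Real.log T)) + 2 * (ε * T * (1 + Real.log T)) +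
          8 * N * (ε * T * (1 + Real.log T)) := by gcongr
      _ = _ := by ring

theorem IsDispersedWith.mono {Ω : Type*} [MeasurableSpace Ω] {μ : Measure Ω} {P : Set ℝ}
    {β L K K' : ℝ} {k : ℕ} {l : ℕ → Ω → ℝ → ℝ} (h : IsDispersedWith μ P β L K k l)
    (hK : K ≤ K') : IsDispersedWith μ P β L K' k l := by
  intro T hT ε hε
  obtain ⟨g, hgi, hg, hgint⟩ := h T hT ε hε
  refine ⟨g, hgi, hg, hgint.trans ?_⟩
  have hT1 : (1 : ℝ) ≤ T := by exact_mod_cast hT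
  have hε0 : 0 ≤ ε := (Real.rpow_nonneg (by linarith) _).trans hε
  have := Real.log_nonneg hT1
  gcongr

end Assembly

theorem mainTheorem1 (n deg : ℕ) (κ : ℝ≥0) (M a b : ℝ) (hab : a < b) :
    ∃ (η : ℕ → ℝ) (K : ℝ) (k : ℕ), (∀ T, 0 < η T ∧ η T ≤ 1) ∧
      ∀ (Ω : Type*) [MeasurableSpace Ω] (μ : Measure Ω) [IsProbabilityMeasure μ]
        (ell : Bool → Bool → ℝ) (_ : ∀ y y', ell y y' ∈ Set.Icc (0 : ℝ) 1)
        (P : Set ℝ) (_ : Set.Icc a b ⊆ P)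
        (I : ℕ → Ω → SSLInstance n) (_ : ∀ t, Measurable (I t))
        (_ : iIndepFun I μ)
        (_ : ∀ t, ∀ᵐ ω ∂μ, ∃ v, (I t ω).labeled v = true)
        (_ : ∀ t, IsBoundedDensity κ (μ.map fun ω => (I t ω).sim))
        (_ : ∀ t, ∀ᵐ ω ∂μ, ∀ e, |(I t ω).sim e| ≤ M)
        (_ : ∀ t, ∀ᵐ ω ∂μ, ∀ α ∈ P, ∀ u v, 0 ≤ (I t ω).polyKernel deg α u v),
        (∀ L : ℝ, 0 ≤ L →
          IsDispersedWith μ P (1 / 2) L K k (fun t ω => (I t ω).loss ell deg)) ∧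
        ∀ T : ℕ, 1 ≤ T →
          (∀ᵐ ω ∂μ,
            IsProbabilityMeasure
              (outputLaw (Set.Icc a b) (η T) (fun t => (I t ω).loss ell deg) T) ∧
            Integrable (regret (Set.Icc a b) (fun t => (I t ω).loss ell deg) T)
              (outputLaw (Set.Icc a b) (η T) (fun t => (I t ω).loss ell deg) T)) ∧
          ExpectationLE μ
            (fun ω => ∫ ρ, regret (Set.Icc a b) (fun t => (I t ω).loss ell deg) T ρ
              ∂(outputLaw (Set.Icc a b) (η T) (fun t => (I t ω).loss ell deg) T))
            (K * Real.sqrt T * (1 + Real.log T) ^ k) := by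
  set K₀ := 4 * crossingConst (labelingPolys n deg) κ M + 2 +
    8 * (∑ q ∈ labelingPolys n deg, q.totalDegree : ℕ)
  have hη1 : ∀ T : ℕ, 1 ≤ Real.sqrt (max (T : ℝ) 1) := fun T =>
    Real.one_le_sqrt.2 (le_max_right _ _)
  -- The step size is `T^(-1/2)`; the maximum matters only for `T = 0`. Beyond the dispersion
  -- constant, `|log (b - a)| + 1` pays for the logarithmic term and the last `1` for `η * T`.
  refine ⟨fun T => (Real.sqrt (max (T : ℝ) 1))⁻¹, K₀ + |Real.log (b - a)| + 2, 1, fun T =>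
    ⟨inv_pos.2 (zero_lt_one.trans_le (hη1 T)), inv_le_one_of_one_le₀ (hη1 T)⟩, ?_⟩
  intro Ω _ μ _ ell hell P hP I hI hind hlab hdens hM hw
  have hreg : ∀ᵐ ω ∂μ, ∀ t, (I t ω).IsRegularOn deg P := by
    filter_upwards [ae_all_iff.2 hlab, ae_all_iff.2 hw] with ω h1 h2 t
    exact ⟨h1 t, h2 t⟩
  have hdisp : ∀ L : ℝ, 0 ≤ L →
      IsDispersedWith μ P (1 / 2) L K₀ 1 (fun t ω => (I t ω).loss ell deg) := fun L hL =>
    isDispersedWith_loss ell hI hind hreg hdens hM hL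
  refine ⟨fun L hL => (hdisp L hL).mono ?_, fun T hT => ?_⟩
  · linarith [abs_nonneg (Real.log (b - a))]
  have hT1 : (1 : ℝ) ≤ T := by exact_mod_cast hT
  have hT0 : (0 : ℝ) < T := by linarith
  have hsT : 1 ≤ Real.sqrt T := Real.one_le_sqrt.2 hT1
  have hlogT : 0 ≤ Real.log T := Real.log_nonneg hT1
  simp only [max_eq_left hT1, pow_one]
  set s := Real.sqrt T with hs
  have hss : s * s = T := Real.mul_self_sqrt hT0.le
  have hs0 : 0 < s := by linarith
  have hη0 : 0 < s⁻¹ := inv_pos.2 hs0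
  have hηle : s⁻¹ ≤ 1 := inv_le_one_of_one_le₀ hsT
  have hl : ∀ ω t ρ, (I t ω).loss ell deg ρ ∈ Set.Icc (0 : ℝ) 1 := fun ω t ρ =>
    (I t ω).loss_mem_Icc hell deg ρ
  have hlm : ∀ ω, (∀ t, (I t ω).IsRegularOn deg P) → ∀ t,
      AEMeasurable ((I t ω).loss ell deg) (volume.restrict (Set.Icc a b)) := fun ω hω t =>
    aemeasurable_of_finite_critical_set (finite_diagonalCrossings (labelingPolys n deg) _)
      fun ρ hρ ρ' hρ' hno => (hω t).loss_eq ell (hP hρ) (hP hρ') hno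
  refine ⟨?_, ?_⟩
  · filter_upwards [hreg] with ω hω
    exact ⟨isProbabilityMeasure_outputLaw hab hη0.le (hl ω) (hlm ω hω) T,
      integrable_regret hab hη0.le (hl ω) (hlm ω hω) T⟩
  · have hεeq : (T : ℝ) ^ (-(1 / 2) : ℝ) = s⁻¹ := by
      rw [Real.rpow_neg hT0.le, hs, Real.sqrt_eq_rpow]
    -- The smallest admissible radius, equal to the step size, makes `ε * T`, `1/η` and `η * T` all
    -- equal to `√T`.
    obtain ⟨g, hgi, hg, hgint⟩ := hdisp 0 le_rfl T hT s⁻¹ hεeq.le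
    refine ⟨fun ω => g ω + (Real.log ((b - a) / min s⁻¹ (b - a)) / s⁻¹ + s⁻¹ * T),
      hgi.add (integrable_const _), ?_, ?_⟩
    · filter_upwards [hg, hreg] with ω hgω hω
      have := integral_regret_le hab hη0 hηle (hl ω) (hlm ω hω) T hP hη0
      linarith
    · rw [integral_add hgi (integrable_const _), integral_const, probReal_univ, one_smul]
      have h1 : s⁻¹ * T = s := by rw [← hss]; field_simp
      have h2 := log_div_min_le (sub_pos.2 hab) hη0 hηle
      rw [Real.log_inv, hs, Real.log_sqrt hT0.le, ← hs] at h2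
      rw [h1, div_inv_eq_mul]
      rw [h1, pow_one] at hgint
      have h3 : Real.log ((b - a) / min s⁻¹ (b - a)) * s ≤
          (|Real.log (b - a)| * (1 + Real.log T) + (1 + Real.log T)) * s := by
        refine mul_le_mul_of_nonneg_right ?_ hs0.le
        nlinarith [abs_nonneg (Real.log (b - a))]
      have h4 : s ≤ s * (1 + Real.log T) := le_mul_of_one_le_right hs0.le (by linarith)
      linarith
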